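/- Let $n\ge 1$, $L,C,\bar C>0$, $R\ge 0$, $\eta>0$, and consider $n$ identical RLC circuits with currents $I_1,\dots,I_n$, coupled through a shared capacitor of capacitance $C(t)=\bar C(1-\eta\cos(2\omega t))$: $$\frac1{C(t)}\sum_{j=1}^n I_j+\frac1C I_i+R\,\dot I_i+L\,\ddot I_i=0,\qquad i=1,\dots,n. \tag{1}$$ Put $\gamma=R/L$, $\epsilon=\eta/(L\bar C)$, assume $\frac1{LC}+\frac n{L\bar C}-\frac{\gamma^2}4>0$ and tune $\omega=\sqrt{\frac1{LC}+\frac n{L\bar C}-\frac{\gamma^2}4}$. With $x=(I_1,\dot I_1,\dots,I_n,\dot I_n)\in\mathbb R^{2n}$ (Euclidean norm), system (1) reads $\dot x=Ax+\epsilon P(t)x+O(\epsilon^2)$, where $A$ has the $2\times2$ diagonal blocks $\begin{bmatrix}0&1\\-\frac1{LC}-\frac1{L\bar C}&-\gamma\end{bmatrix}$ and off-diagonal blocks $\begin{bmatrix}0&0\\-\frac1{L\bar C}&0\end{bmatrix}$, and all $2\times 2$ blocks of $P(t)$ equal $\begin{bmatrix}0&0\\-\cos(2\omega t)&0\end{bmatrix}$.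 "Unbounded" means unbounded on $[0,\infty)$. (a) (Leading-order solution, all parameter values.) The effective matrix $B=\lim_{T\to\infty}\frac1T\int_0^T e^{-A\tau}P(\tau)e^{A\tau}\,d\tau$ exists, and there is a linear subspace $E\subset\mathbb R^{2n}$ of dimension $2n-1$ such that, for every $x(0)\notin E$, the homogenized solution $x(t)=e^{At}e^{\epsilon Bt}x(0)$ has $\|x(t)\|$ unbounded if and only if $\epsilon\frac n\omega>2\gamma$. (b) (Solutions of the equations, small fluctuations.) For every $\theta>0$ there is a $\delta>0$, depending only on $\theta$, such that the following holds for all $n,L,C,\bar C,R,\eta$ as above with $\epsilon n\le\delta\omega^2$ and $|\epsilon\frac n\omega-2\gamma|\ge\theta\cdot 2\gamma$. There is a linear subspace $E\subset\mathbb R^{2n}$ of dimension $2n-1$ such that, for every solution $x$ of $\dot x=Ax+\epsilon P(t)x$ on $[0,\infty)$ with $x(0)\notin E$, $\|x(t)\|$ is unbounded if and only if $\epsilon\frac n\omega>2\gamma$. If moreover $\eta\le\delta$, the same (with a possibly different $E$) holds for the solutions of the circuit equations (1). -/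

import Mathlib

open scoped Matrix

/-- Data of `n` identical RLC circuits (inductance `L`, capacitance `C`, resistance `R`) that share
one capacitor of capacitance `Cbar * (1 - η * cos (2 ω t))`. -/
structure CoupledRLC where
  n : ℕ
  L : ℝ
  C : ℝ
  Cbar : ℝ
  R : ℝ
  η : ℝ
  n_pos : 0 < n
  L_pos : 0 < L
  C_pos : 0 < C
  Cbar_pos : 0 < Cbar
  R_nonneg : 0 ≤ R
  η_pos : 0 < η

namespace CoupledRLC

noncomputable section

variable (c : CoupledRLC)

/-- The damping rate `γ = R / L`. -/
def γ : ℝ := c.R / c.L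

/-- The size `ε = η / (L C̄)` of the parametric perturbation. -/
def ε : ℝ := c.η / (c.L * c.Cbar)

/-- The quantity `1/(LC) + n/(LC̄) - γ²/4` under the square root in the tuned frequency. -/
def omegaSq : ℝ := 1 / (c.L * c.C) + c.n / (c.L * c.Cbar) - c.γ ^ 2 / 4

/-- The tuned frequency `ω`. -/
def ω : ℝ := Real.sqrt c.omegaSq

/-- The fluctuating capacitance `C(t)` of the shared capacitor. -/
def sharedCapacitance (t : ℝ) : ℝ := c.Cbar * (1 - c.η * Real.cos (2 * c.ω * t))

/-- The state space `ℝ²ⁿ` with its Euclidean norm: the coordinate `(i, 0)` is the current `Iᵢ` in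
the `i`-th circuit and the coordinate `(i, 1)` is the derivative of this current. -/
abbrev State : Type := EuclideanSpace ℝ (Fin c.n × Fin 2)

/-- `x = (I₁, I₁', …, Iₙ, Iₙ')` obeys, for all times `t ≥ 0`, the circuit equations
`(1 / C(t)) ∑ⱼ Iⱼ + (1 / C) Iᵢ + R Iᵢ' + L Iᵢ'' = 0`, for `i = 1, …, n`. -/
structure IsCircuitSolution (x : ℝ → c.State) : Prop where
  current : ∀ i : Fin c.n, ∀ t : ℝ, 0 ≤ t →
    HasDerivWithinAt (fun s => x s (i, 0)) (x t (i, 1)) (Set.Ici 0) t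
  kirchhoff : ∀ i : Fin c.n, ∀ t : ℝ, 0 ≤ t → ∃ d : ℝ,
    HasDerivWithinAt (fun s => x s (i, 1)) d (Set.Ici 0) t ∧
      1 / c.sharedCapacitance t * ∑ j : Fin c.n, x t (j, 0) + 1 / c.C * x t (i, 0)
        + c.R * x t (i, 1) + c.L * d = 0

/-- The diagonal `2 × 2` block of `A`. -/
def diagBlock : Matrix (Fin 2) (Fin 2) ℝ :=
  !![0, 1; -(1 / (c.L * c.C)) - 1 / (c.L * c.Cbar), -(c.R / c.L)]

/-- The off-diagonal `2 × 2` block of `A`. -/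
def offBlock : Matrix (Fin 2) (Fin 2) ℝ :=
  !![0, 0; -(1 / (c.L * c.Cbar)), 0]

/-- The `2 × 2` block that fills `P(t)`. -/
def forcingBlock (t : ℝ) : Matrix (Fin 2) (Fin 2) ℝ :=
  !![0, 0; -Real.cos (2 * c.ω * t), 0]

/-- The constant `2n × 2n` matrix `A` of the system `x' = A x + ε P(t) x`. -/
def A : Matrix (Fin c.n × Fin 2) (Fin c.n × Fin 2) ℝ :=
  Matrix.of fun p q => if p.1 = q.1 then c.diagBlock p.2 q.2 else c.offBlock p.2 q.2

/-- The periodic `2n × 2n` matrix `P(t)` of the system `x' = A x + ε P(t) x`. -/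
def P (t : ℝ) : Matrix (Fin c.n × Fin 2) (Fin c.n × Fin 2) ℝ :=
  Matrix.of fun p q => c.forcingBlock t p.2 q.2

/-- `x` solves the first-order system `x' = A x + ε P(t) x` for all times `t ≥ 0`. -/
def IsFirstOrderSolution (x : ℝ → c.State) : Prop :=
  ∀ t : ℝ, 0 ≤ t →
    HasDerivWithinAt x (WithLp.toLp 2 ((c.A + c.ε • c.P t) *ᵥ (x t).ofLp)) (Set.Ici 0) t

/-- `B` is the effective matrix of `x' = A x + ε P(t) x`, that is,
`B = lim_{T → ∞} (1/T) ∫₀ᵀ exp(-Aτ) P(τ) exp(Aτ) dτ` (entry by entry). -/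
def IsEffectiveMatrix (B : Matrix (Fin c.n × Fin 2) (Fin c.n × Fin 2) ℝ) : Prop :=
  ∀ p q : Fin c.n × Fin 2, Filter.Tendsto
    (fun T : ℝ => 1 / T * ∫ τ in (0 : ℝ)..T,
      (NormedSpace.exp (-(τ • c.A)) * c.P τ * NormedSpace.exp (τ • c.A)) p q)
    Filter.atTop (nhds (B p q))

/-- The homogenized trajectory `exp(At) exp(εBt) x₀`. -/
def homogenized (B : Matrix (Fin c.n × Fin 2) (Fin c.n × Fin 2) ℝ) (x₀ : c.State) (t : ℝ) :
    c.State :=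
  WithLp.toLp 2 ((NormedSpace.exp (t • c.A) * NormedSpace.exp ((c.ε * t) • B)) *ᵥ x₀.ofLp)

/-- `t ↦ ‖x(t)‖` is unbounded on `[0, ∞)`. -/
def IsUnbounded (x : ℝ → c.State) : Prop :=
  ¬ ∃ M : ℝ, ∀ t : ℝ, 0 ≤ t → ‖x t‖ ≤ M

end

end CoupledRLC

/-! Only the sum of the circuits feels the modulation. Deviations from the mean obey a damped
oscillator without forcing, so their energy never increases (`IsModulated.deviationEnergy_le`). The
sum `S` and its quadrature `V` obey a damped Mathieu equation driven at twice its frequency.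
Removing the factor `exp (-γt/2)` and the rotation at frequency `ω` leaves slow amplitudes `a`, `b`
(`IsModulated.isAmplitudePair`). With `μ = εn/ω`, their averaged equations are `a' = -μb/4`, `b' =
-μa/4`: the direction `a = -b` grows like `exp (μt/4)`. Hence `S² + V²` grows at most at about the
rate `μ/2 - γ`, and attains it along that direction, which gives the threshold `μ > 2γ`.

For the true solutions, averaging is made rigorous by quadratic forms corrected with oscillating
terms of relative size `μ/ω`. They yield a lower and an upper exponential bound whose rates differ
from `μ/2` by a relative error `O(δ)` (`exp_le_sq_add_sq`, `sq_add_sq_le_exp`). A fixed relative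
distance from the threshold absorbs this error. For the homogenized solution the rates are exact:
`exp(At)` scales `S² + V²` by `exp (-γt)`, while `B` fixes the deviations and acts hyperbolically on
`S - V` and `S + V`.

The exceptional set comes from linearity: initial values of bounded trajectories form a subspace,
and one initial value with only unbounded trajectories makes it proper (`exists_hyperplane`). -/

/-! ### Exponential comparison and elementary inequalities. -/

open Real Set in
theorem le_mul_exp_of_hasDerivWithinAt_le {f f' : ℝ → ℝ} {r : ℝ}
    (hf : ∀ t, 0 ≤ t → HasDerivWithinAt f (f' t) (Ici 0) t)
    (hle : ∀ t, 0 ≤ t → f' t ≤ r * f t) {t : ℝ} (ht : 0 ≤ t) :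
    f t ≤ f 0 * exp (r * t) := by
  have hg : ∀ s, 0 ≤ s → HasDerivWithinAt (fun s => f s * exp (-(r * s)))
      (f' s * exp (-(r * s)) + f s * (exp (-(r * s)) * -(r * 1))) (Ici 0) s := fun s hs =>
    (hf s hs).mul ((((hasDerivAt_id s).const_mul r).neg.exp).hasDerivWithinAt)
  have anti : AntitoneOn (fun s => f s * exp (-(r * s))) (Ici 0) := by
    refine antitoneOn_of_deriv_nonpos (convex_Ici 0) (fun s hs => (hg s hs).continuousWithinAt)
      (fun s hs => ?_) (fun s hs => ?_)
    · exact ((hg s (interior_subset hs)).mono interior_subset).differentiableWithinAt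
    · rw [interior_Ici] at hs
      rw [((hg s (le_of_lt hs)).hasDerivAt (Ici_mem_nhds hs)).deriv]
      have h1 := hle s (le_of_lt hs)
      have h2 := exp_pos (-(r * s))
      nlinarith
  have h := anti (self_mem_Ici) (show t ∈ Ici 0 from ht) ht
  simp only [mul_zero, neg_zero, exp_zero, mul_one] at h
  calc f t = f t * exp (-(r * t)) * exp (r * t) := by
        rw [mul_assoc, ← exp_add]; simp
    _ ≤ f 0 * exp (r * t) := by gcongr

open Real Set in
theorem mul_exp_le_of_le_hasDerivWithinAt {f f' : ℝ → ℝ} {r : ℝ}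
    (hf : ∀ t, 0 ≤ t → HasDerivWithinAt f (f' t) (Ici 0) t)
    (hle : ∀ t, 0 ≤ t → r * f t ≤ f' t) {t : ℝ} (ht : 0 ≤ t) :
    f 0 * exp (r * t) ≤ f t := by
  have := le_mul_exp_of_hasDerivWithinAt_le (f := fun t => -f t) (f' := fun t => -f' t) (r := r)
    (fun t ht => (hf t ht).neg) (fun t ht => by linarith [hle t ht]) ht
  linarith

open Real Set in
theorem eq_mul_exp_of_hasDerivWithinAt {f : ℝ → ℝ} {r : ℝ}
    (hf : ∀ t, 0 ≤ t → HasDerivWithinAt f (r * f t) (Ici 0) t) {t : ℝ} (ht : 0 ≤ t) :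
    f t = f 0 * exp (r * t) :=
  le_antisymm (le_mul_exp_of_hasDerivWithinAt_le hf (fun _ _ => le_rfl) ht)
    (mul_exp_le_of_le_hasDerivWithinAt hf (fun _ _ => le_rfl) ht)

theorem abs_mul_le_sq_add_sq (a b : ℝ) : |a * b| ≤ (a ^ 2 + b ^ 2) / 2 := by
  rw [abs_le]
  constructor <;> nlinarith [sq_nonneg (a + b), sq_nonneg (a - b)]

theorem abs_mul_mul_le {x y z K Z : ℝ} (hx : |x| ≤ K) (hy : |y| ≤ 1) (hz : |z| ≤ Z) :
    |x * y * z| ≤ K * Z := by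
  rw [abs_mul, abs_mul]
  have hK : 0 ≤ K := (abs_nonneg x).trans hx
  calc |x| * |y| * |z| ≤ K * 1 * Z := by gcongr
    _ = K * Z := by ring

/-! ### Averaging of the amplitudes at resonance. -/

/-- The system of the slowly varying amplitudes `a`, `b` of the oscillation
`a cos ωt + b sin ωt`, modulated by `m` with strength `μ`. -/
structure IsAmplitudePair (ω μ : ℝ) (m a b : ℝ → ℝ) : Prop where
  left : ∀ t, 0 ≤ t → HasDerivWithinAt a (μ * m t * Real.sin (ω * t) *
    (a t * Real.cos (ω * t) + b t * Real.sin (ω * t))) (Set.Ici 0) t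
  right : ∀ t, 0 ≤ t → HasDerivWithinAt b (-(μ * m t * Real.cos (ω * t) *
    (a t * Real.cos (ω * t) + b t * Real.sin (ω * t)))) (Set.Ici 0) t

/-- `(ac + bs, as - bc)` is the image of `(a, b)` under an orthogonal map, so its squares also sum
to `a² + b²`. -/
theorem sq_add_sq_bounds {a b s c : ℝ} (h : s ^ 2 + c ^ 2 = 1) :
    |a * (a * c + b * s)| ≤ a ^ 2 + b ^ 2 ∧ |b * (a * c + b * s)| ≤ a ^ 2 + b ^ 2 ∧
    |a ^ 2 * c ^ 2 - b ^ 2 * s ^ 2| ≤ a ^ 2 + b ^ 2 ∧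
    |(a * c + b * s) * (a * s - b * c)| ≤ a ^ 2 + b ^ 2 := by
  have hU : (a * c + b * s) ^ 2 + (a * s - b * c) ^ 2 = a ^ 2 + b ^ 2 := by
    linear_combination (a ^ 2 + b ^ 2) * h
  have hU' : (a * c + b * s) ^ 2 ≤ a ^ 2 + b ^ 2 := by nlinarith [sq_nonneg (a * s - b * c)]
  have hs : s ^ 2 ≤ 1 := by nlinarith [sq_nonneg c]
  have hc : c ^ 2 ≤ 1 := by nlinarith [sq_nonneg s]
  refine ⟨?_, ?_, ?_, ?_⟩
  · refine (abs_mul_le_sq_add_sq _ _).trans ?_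
    nlinarith [sq_nonneg b]
  · refine (abs_mul_le_sq_add_sq _ _).trans ?_
    nlinarith [sq_nonneg a]
  · rw [abs_le]
    constructor <;> nlinarith [mul_nonneg (sq_nonneg a) (sq_nonneg c),
      mul_nonneg (sq_nonneg b) (sq_nonneg s), mul_le_mul_of_nonneg_left hs (sq_nonneg b),
      mul_le_mul_of_nonneg_left hc (sq_nonneg a), sq_nonneg a, sq_nonneg b]
  · refine (abs_mul_le_sq_add_sq _ _).trans ?_
    nlinarith [sq_nonneg a, sq_nonneg b]

/-- Error budget for the lower bound: `X₃` carries the deviation of the modulation from the cosine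
and costs `4δ`; `X₁`, `X₂` come from differentiating `a`, `b` inside the correction and cost less
than `3δ`. Their total stays below `9δ`. -/
theorem growth_rate_lower {κ δ ω Q X₁ X₂ X₃ : ℝ} (hκ : 0 ≤ κ) (hκδ : κ ≤ δ) (hω : 0 ≤ ω)
    (hQ : 0 ≤ Q) (h₃ : -(2 * δ * Q) ≤ X₃) (h₁ : X₁ ≤ 5 / 16 * (51 / 50 * Q))
    (h₂ : X₂ ≤ 5 / 16 * (51 / 50 * Q)) :
    ω * κ * (1 / 2 - 9 * δ) * Q ≤
      κ * ω / 2 * Q + 2 * (κ * ω) * X₃ - 4 * κ * (κ * ω) * (X₁ + X₂) := by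
  have hz : 0 ≤ κ * ω := by positivity
  have j₃ := mul_le_mul_of_nonneg_left h₃ (by positivity : 0 ≤ 2 * (κ * ω))
  have j₁₂ := mul_le_mul_of_nonneg_left (add_le_add h₁ h₂) (by positivity : 0 ≤ 4 * κ * (κ * ω))
  have k₁ : κ * ((κ * ω) * Q) ≤ δ * ((κ * ω) * Q) := by gcongr
  have k₂ : 0 ≤ κ * ((κ * ω) * Q) := by positivity
  linarith

/-- Error budget for the upper bound: `4δ` from the modulation error `X₃` and at most `2δ` from the
four second-order terms. -/
theorem growth_rate_upper {κ δ ω Q Y X₁ X₂ X₃ X₄ X₅ : ℝ} (hκ : 0 ≤ κ) (hκδ : κ ≤ δ) (hω : 0 ≤ ω)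
    (hQ : 0 ≤ Q) (h₀ : -(Q / 2) ≤ Y) (h₃ : X₃ ≤ 2 * δ * Q) (h₁ : X₁ ≤ 1 * (51 / 50 * Q))
    (h₂ : X₂ ≤ 1 * (51 / 50 * Q)) (h₄ : X₄ ≤ 1 * (51 / 50 * Q)) (h₅ : -(1 * (51 / 50 * Q)) ≤ X₅) :
    -(κ * ω) * Y + 2 * (κ * ω) * X₃
      + κ * (κ * ω) * (1 / 4 * X₁ + 1 / 4 * X₂ + 1 / 4 * X₄ - 1 / 4 * X₅)
      ≤ κ * ω * (1 / 2 + 6 * δ) * Q := by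
  have hz : 0 ≤ κ * ω := by positivity
  have j₀ := mul_le_mul_of_nonneg_left h₀ hz
  have j₃ := mul_le_mul_of_nonneg_left h₃ (by positivity : 0 ≤ 2 * (κ * ω))
  have jj := mul_le_mul_of_nonneg_left
    (show 1 / 4 * X₁ + 1 / 4 * X₂ + 1 / 4 * X₄ - 1 / 4 * X₅ ≤ 2 * Q by linarith)
    (by positivity : 0 ≤ κ * (κ * ω))
  have k₁ : κ * ((κ * ω) * Q) ≤ δ * ((κ * ω) * Q) := by gcongr
  linarith

namespace IsAmplitudePair

open Real Set

variable {ω μ δ : ℝ} {m a b : ℝ → ℝ}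

/-- The form `-2ab` is largest relative to `a² + b²` on the growing direction `a = -b`, and its
averaged derivative is `μ/2 * (a² + b²)`, which dominates `μ/2` times the form itself. -/
theorem exp_le_sq_add_sq (h : IsAmplitudePair ω μ m a b) (hω : 0 < ω) (hμ : 0 ≤ μ)
    (hδ : δ ≤ 1 / 100) (hμδ : μ ≤ δ * ω)
    (hm : ∀ t, 0 ≤ t → |m t - cos (2 * (ω * t))| ≤ 2 * δ) (ha : a 0 = 1) (hb : b 0 = -1)
    {t : ℝ} (ht : 0 ≤ t) :
    exp (μ / 2 * (1 - 19 * δ) * t) ≤ a t ^ 2 + b t ^ 2 := by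
  obtain ⟨κ, rfl⟩ : ∃ κ, μ = κ * ω := ⟨μ / ω, by field_simp⟩
  have hκ : 0 ≤ κ := nonneg_of_mul_nonneg_left hμ hω
  have hκδ : κ ≤ δ := le_of_mul_le_mul_right hμδ hω
  have hδ0 : 0 ≤ δ := hκ.trans hκδ
  -- Up to the factor `1/ω` in time, these are primitives of the mean-free parts of `cos 2φ cos² φ`
  -- (mean `1/4`) and `cos 2φ sin² φ` (mean `-1/4`), with `φ = ωt`.
  set w₁ : ℝ → ℝ := fun t => sin (2 * (ω * t)) / 4 + sin (4 * (ω * t)) / 16 with hw₁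
  set w₂ : ℝ → ℝ := fun t => sin (2 * (ω * t)) / 4 - sin (4 * (ω * t)) / 16 with hw₂
  have dsin : ∀ (k t : ℝ), HasDerivWithinAt (fun t => sin (k * (ω * t)))
      (cos (k * (ω * t)) * (k * (ω * 1))) (Ici 0) t := fun k t =>
    ((((hasDerivAt_id t).const_mul ω).const_mul k).sin).hasDerivWithinAt
  have hwb : ∀ t, |w₁ t| ≤ 5 / 16 ∧ |w₂ t| ≤ 5 / 16 := fun t => by
    have h1 := sin_le_one (2 * (ω * t))
    have h2 := neg_one_le_sin (2 * (ω * t))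
    have h3 := sin_le_one (4 * (ω * t))
    have h4 := neg_one_le_sin (4 * (ω * t))
    constructor <;> rw [abs_le] <;> constructor <;> simp only [hw₁, hw₂] <;> linarith
  -- The correction cancels the oscillating part of the derivative of `-2ab`, namely of `2μm(a² cos²
  -- φ - b² sin² φ)`, to first order in `κ = μ/ω`.
  set D : ℝ → ℝ := fun t =>
    -2 * (a t * b t) - 2 * κ * (w₁ t * a t ^ 2 - w₂ t * b t ^ 2) with hD
  have hDQ : ∀ t, |D t - -2 * (a t * b t)| ≤ 5 / 8 * κ * (a t ^ 2 + b t ^ 2) := fun t => by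
    have hw := hwb t
    rw [abs_le, abs_le] at hw
    have e : D t - -2 * (a t * b t) = -2 * κ * (w₁ t * a t ^ 2 - w₂ t * b t ^ 2) := by
      simp only [hD]; ring
    have : |w₁ t * a t ^ 2 - w₂ t * b t ^ 2| ≤ 5 / 16 * (a t ^ 2 + b t ^ 2) := by
      rw [abs_le]
      constructor <;> nlinarith [sq_nonneg (a t), sq_nonneg (b t)]
    rw [e, abs_mul, abs_mul, abs_of_nonneg hκ, abs_neg, abs_two]
    nlinarith
  have hDle : ∀ t, D t ≤ (1 + δ) * (a t ^ 2 + b t ^ 2) := fun t => by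
    have h1 := (abs_le.1 (hDQ t)).2
    nlinarith [sq_nonneg (a t + b t), mul_nonneg (sub_nonneg.2 hκδ) (add_nonneg (sq_nonneg (a t))
      (sq_nonneg (b t))), mul_nonneg hκ (add_nonneg (sq_nonneg (a t)) (sq_nonneg (b t)))]
  have hderiv : ∀ t, 0 ≤ t → ∃ D', HasDerivWithinAt D D' (Ici 0) t ∧
      κ * ω / 2 * (1 - 19 * δ) * D t ≤ D' := fun t ht => by
    have da := h.left t ht
    have db := h.right t ht
    have dw1 := ((dsin 2 t).div_const 4).add ((dsin 4 t).div_const 16)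
    have dw2 := ((dsin 2 t).div_const 4).sub ((dsin 4 t).div_const 16)
    have dD := ((da.mul db).const_mul (-2)).sub
      (((dw1.mul (da.pow 2)).sub (dw2.mul (db.pow 2))).const_mul (2 * κ))
    refine ⟨_, dD, ?_⟩
    have hc2 : cos (2 * (ω * t)) = 1 - 2 * sin (ω * t) ^ 2 := by
      rw [cos_two_mul, cos_sq']; ring
    have hc4 : cos (4 * (ω * t)) = 2 * cos (2 * (ω * t)) ^ 2 - 1 := by
      rw [← cos_two_mul]; ring_nf
    have hsc : sin (ω * t) ^ 2 + cos (ω * t) ^ 2 = 1 := sin_sq_add_cos_sq _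
    have hr := hm t ht
    obtain ⟨b1, b2, b3, -⟩ := sq_add_sq_bounds (a := a t) (b := b t) hsc
    have hs1 := abs_sin_le_one (ω * t)
    have hc1 := abs_cos_le_one (ω * t)
    have hm1 : |m t| ≤ 51 / 50 := by
      have := abs_cos_le_one (2 * (ω * t))
      have := abs_sub_abs_le_abs_sub (m t) (cos (2 * (ω * t)))
      linarith
    have e1 := abs_mul_mul_le hm1 hs1 b1
    have e2 := abs_mul_mul_le hm1 hc1 b2
    set Q := a t ^ 2 + b t ^ 2 with hQ
    have hQ0 : 0 ≤ Q := by positivity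
    have e1' := abs_mul_mul_le (hwb t).1 (abs_one.le) e1
    have e2' := abs_mul_mul_le (hwb t).2 (abs_one.le) e2
    have e3 := abs_mul_mul_le hr (abs_one.le) b3
    have key : ω * κ * (1 / 2 - 9 * δ) * Q ≤ κ * ω / 2 * Q
        + 2 * (κ * ω) * ((m t - cos (2 * (ω * t))) * 1 *
          (a t ^ 2 * cos (ω * t) ^ 2 - b t ^ 2 * sin (ω * t) ^ 2))
        - 4 * κ * (κ * ω) * (w₁ t * 1 * (m t * sin (ω * t) *
          (a t * (a t * cos (ω * t) + b t * sin (ω * t)))) + w₂ t * 1 * (m t * cos (ω * t) *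
          (b t * (a t * cos (ω * t) + b t * sin (ω * t))))) := by
      have i3 := (abs_le.1 e3).1
      have i1 := (abs_le.1 e1').2
      have i2 := (abs_le.1 e2').2
      exact growth_rate_lower hκ hκδ hω.le hQ0 i3 i1 i2
    have hfin : κ * ω / 2 * (1 - 19 * δ) * D t ≤ ω * κ * (1 / 2 - 9 * δ) * Q := by
      have : (1 - 19 * δ) * D t ≤ (1 - 19 * δ) * ((1 + δ) * Q) := by
        gcongr
        · linarith
        · exact hDle t
      have h2 : (1 - 19 * δ) * ((1 + δ) * Q) ≤ (1 - 18 * δ) * Q := by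
        linarith [mul_nonneg (mul_nonneg hδ0 hδ0) hQ0]
      have h3 := mul_le_mul_of_nonneg_left (this.trans h2) (by positivity : 0 ≤ κ * ω / 2)
      linarith
    refine hfin.trans (key.trans (le_of_eq ?_))
    simp only [hw₁, hw₂, hQ, hc4, Pi.pow_apply, Pi.add_apply, Pi.sub_apply]
    have hcc : cos (ω * t) ^ 2 = 1 - sin (ω * t) ^ 2 := by linarith
    generalize sin (4 * (ω * t)) = s4
    generalize sin (2 * (ω * t)) = s2
    rw [hc2]
    generalize sin (ω * t) = s at *
    generalize cos (ω * t) = c at *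
    norm_num
    linear_combination (-2 * (κ * ω) * (1 - 2 * s ^ 2) * a t ^ 2) * hcc
  choose! D' hD' hDD' using hderiv
  have h0 := mul_exp_le_of_le_hasDerivWithinAt (r := κ * ω / 2 * (1 - 19 * δ)) hD' hDD' ht
  have hD0 : D 0 = 2 := by simp [hD, hw₁, hw₂, ha, hb]
  rw [hD0] at h0
  have h1 := hDle t
  have : 0 ≤ a t ^ 2 + b t ^ 2 := by positivity
  nlinarith [exp_pos (κ * ω / 2 * (1 - 19 * δ) * t)]

/-- The averaged derivative of `a² + b²` is `-μab`, at most `μ/2 * (a² + b²)`. -/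
theorem sq_add_sq_le_exp (h : IsAmplitudePair ω μ m a b) (hω : 0 < ω) (hμ : 0 ≤ μ)
    (hδ : δ ≤ 1 / 100) (hμδ : μ ≤ δ * ω)
    (hm : ∀ t, 0 ≤ t → |m t - cos (2 * (ω * t))| ≤ 2 * δ)
    {t : ℝ} (ht : 0 ≤ t) :
    a t ^ 2 + b t ^ 2 ≤ 2 * (a 0 ^ 2 + b 0 ^ 2) * exp (μ / 2 * (1 + 13 * δ) * t) := by
  obtain ⟨κ, rfl⟩ : ∃ κ, μ = κ * ω := ⟨μ / ω, by field_simp⟩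
  have hκ : 0 ≤ κ := nonneg_of_mul_nonneg_left hμ hω
  have hκδ : κ ≤ δ := le_of_mul_le_mul_right hμδ hω
  have hδ0 : 0 ≤ δ := hκ.trans hκδ
  have dsin : ∀ (k t : ℝ), HasDerivWithinAt (fun t => sin (k * (ω * t)))
      (cos (k * (ω * t)) * (k * (ω * 1))) (Ici 0) t := fun k t =>
    ((((hasDerivAt_id t).const_mul ω).const_mul k).sin).hasDerivWithinAt
  have dcos : ∀ (k t : ℝ), HasDerivWithinAt (fun t => cos (k * (ω * t)))
      (-sin (k * (ω * t)) * (k * (ω * 1))) (Ici 0) t := fun k t =>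
    ((((hasDerivAt_id t).const_mul ω).const_mul k).cos).hasDerivWithinAt
  -- For `m = cos 2φ` the derivative of `a² + b²` is `μ((a² - b²) sin 4φ / 2 - ab - ab cos 4φ)`; the
  -- correction removes its two oscillating terms to first order in `κ`.
  set D : ℝ → ℝ := fun t => (a t ^ 2 + b t ^ 2) + κ * ((a t ^ 2 - b t ^ 2) *
    (cos (4 * (ω * t)) / 8) + a t * b t * (sin (4 * (ω * t)) / 4)) with hD
  have hDQ : ∀ t, |D t - (a t ^ 2 + b t ^ 2)| ≤ δ / 4 * (a t ^ 2 + b t ^ 2) := fun t => by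
    have e : D t - (a t ^ 2 + b t ^ 2) = κ * ((a t ^ 2 - b t ^ 2) *
        (cos (4 * (ω * t)) / 8) + a t * b t * (sin (4 * (ω * t)) / 4)) := by
      simp only [hD]; ring
    have h1 : |(a t ^ 2 - b t ^ 2) * (cos (4 * (ω * t)) / 8)| ≤ (a t ^ 2 + b t ^ 2) * (1 / 8) := by
      rw [abs_mul]
      gcongr
      · rw [abs_le]; constructor <;> nlinarith [sq_nonneg (a t), sq_nonneg (b t)]
      · rw [abs_div]; norm_num; gcongr; exact abs_cos_le_one _
    have h2 : |a t * b t * (sin (4 * (ω * t)) / 4)| ≤ (a t ^ 2 + b t ^ 2) / 2 * (1 / 4) := by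
      rw [abs_mul]
      gcongr
      · exact abs_mul_le_sq_add_sq _ _
      · rw [abs_div]; norm_num; gcongr; exact abs_sin_le_one _
    rw [e, abs_mul, abs_of_nonneg hκ]
    have h3 := (abs_add_le _ _).trans (add_le_add h1 h2)
    have h4 : κ * ((a t ^ 2 + b t ^ 2) * (1 / 4)) ≤ δ * ((a t ^ 2 + b t ^ 2) * (1 / 4)) := by
      gcongr
    linarith [mul_le_mul_of_nonneg_left h3 hκ]
  have hderiv : ∀ t, 0 ≤ t → ∃ D', HasDerivWithinAt D D' (Ici 0) t ∧
      D' ≤ κ * ω / 2 * (1 + 13 * δ) * D t := fun t ht => by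
    have da := h.left t ht
    have db := h.right t ht
    have dD := ((da.pow 2).add (db.pow 2)).add (((((da.pow 2).sub (db.pow 2)).mul
      ((dcos 4 t).div_const 8)).add ((da.mul db).mul ((dsin 4 t).div_const 4))).const_mul κ)
    refine ⟨_, dD, ?_⟩
    have hc2 : cos (2 * (ω * t)) = 1 - 2 * sin (ω * t) ^ 2 := by
      rw [cos_two_mul, cos_sq']; ring
    have hc4 : cos (4 * (ω * t)) = 2 * cos (2 * (ω * t)) ^ 2 - 1 := by
      rw [← cos_two_mul]; ring_nf
    have hs2 : sin (2 * (ω * t)) = 2 * sin (ω * t) * cos (ω * t) := sin_two_mul _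
    have hs4 : sin (4 * (ω * t)) = 2 * sin (2 * (ω * t)) * cos (2 * (ω * t)) := by
      rw [← sin_two_mul]; ring_nf
    have hsc : sin (ω * t) ^ 2 + cos (ω * t) ^ 2 = 1 := sin_sq_add_cos_sq _
    have hr := hm t ht
    obtain ⟨b1, b2, -, b3⟩ := sq_add_sq_bounds (a := a t) (b := b t) hsc
    have hs1 := abs_sin_le_one (ω * t)
    have hc1 := abs_cos_le_one (ω * t)
    have hm1 : |m t| ≤ 51 / 50 := by
      have := abs_cos_le_one (2 * (ω * t))
      have := abs_sub_abs_le_abs_sub (m t) (cos (2 * (ω * t)))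
      linarith
    have hc41 := abs_cos_le_one (4 * (ω * t))
    have hs41 := abs_sin_le_one (4 * (ω * t))
    set Q := a t ^ 2 + b t ^ 2 with hQ
    have hQ0 : 0 ≤ Q := by positivity
    have e1 := abs_mul_mul_le abs_one.le hc41 (abs_mul_mul_le hm1 hs1 b1)
    have e2 := abs_mul_mul_le abs_one.le hc41 (abs_mul_mul_le hm1 hc1 b2)
    have e4 := abs_mul_mul_le abs_one.le hs41 (abs_mul_mul_le hm1 hs1 b2)
    have e5 := abs_mul_mul_le abs_one.le hs41 (abs_mul_mul_le hm1 hc1 b1)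
    have e3 := abs_mul_mul_le hr (abs_one.le) b3
    have e6 := (abs_le.1 (abs_mul_le_sq_add_sq (a t) (b t))).1
    set U := a t * cos (ω * t) + b t * sin (ω * t) with hU
    have key : -(κ * ω) * (a t * b t)
        + 2 * (κ * ω) * ((m t - cos (2 * (ω * t))) * 1 *
          (U * (a t * sin (ω * t) - b t * cos (ω * t))))
        + κ * (κ * ω) * (1 / 4 * (1 * cos (4 * (ω * t)) * (m t * sin (ω * t) * (a t * U)))
          + 1 / 4 * (1 * cos (4 * (ω * t)) * (m t * cos (ω * t) * (b t * U)))
          + 1 / 4 * (1 * sin (4 * (ω * t)) * (m t * sin (ω * t) * (b t * U)))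
          - 1 / 4 * (1 * sin (4 * (ω * t)) * (m t * cos (ω * t) * (a t * U))))
        ≤ κ * ω * (1 / 2 + 6 * δ) * Q := by
      have i3 := (abs_le.1 e3).2
      have i1 := (abs_le.1 e1).2
      have i2 := (abs_le.1 e2).2
      have i4 := (abs_le.1 e4).2
      have i5 := (abs_le.1 e5).1
      exact growth_rate_upper hκ hκδ hω.le hQ0 e6 i3 i1 i2 i4 i5
    have hfin : κ * ω * (1 / 2 + 6 * δ) * Q ≤ κ * ω / 2 * (1 + 13 * δ) * D t := by
      have h1 := (abs_le.1 (hDQ t)).1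
      have h2 : (1 + 13 * δ) * ((1 - δ / 4) * Q) ≤ (1 + 13 * δ) * D t := by
        gcongr
        rw [← hQ] at h1
        linarith
      have h4 : (1 + 12 * δ) * Q ≤ (1 + 13 * δ) * ((1 - δ / 4) * Q) := by
        linarith [mul_nonneg hδ0 hQ0, mul_nonneg (mul_nonneg hδ0 hQ0) (sub_nonneg.2 hδ)]
      have h3 := mul_le_mul_of_nonneg_left (h4.trans h2) (by positivity : 0 ≤ κ * ω / 2)
      linarith
    refine (le_of_eq ?_).trans (key.trans hfin)
    simp only [hU, Pi.pow_apply, Pi.sub_apply, Pi.mul_apply]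
    have hcc : cos (ω * t) ^ 2 = 1 - sin (ω * t) ^ 2 := by linarith
    rw [hs4, hc4, hs2, hc2]
    generalize sin (ω * t) = s at *
    generalize cos (ω * t) = c at *
    norm_num
    linear_combination (-2 * (κ * ω) * (1 - 2 * s ^ 2) * (a t * b t)) * hcc
  choose! D' hD' hDD' using hderiv
  have h0 := le_mul_exp_of_hasDerivWithinAt_le (r := κ * ω / 2 * (1 + 13 * δ)) hD' hDD' ht
  have h1 := (abs_le.1 (hDQ t)).1
  have h2 := (abs_le.1 (hDQ 0)).2
  have hQ : 0 ≤ a t ^ 2 + b t ^ 2 := by positivity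
  have hQ0 : 0 ≤ a 0 ^ 2 + b 0 ^ 2 := by positivity
  have hE := exp_pos (κ * ω / 2 * (1 + 13 * δ) * t)
  set e := exp (κ * ω / 2 * (1 + 13 * δ) * t)
  have h3 : D 0 ≤ 1.01 * (a 0 ^ 2 + b 0 ^ 2) := by nlinarith
  have h4 : 0.99 * (a t ^ 2 + b t ^ 2) ≤ D t := by nlinarith
  have h5 := mul_le_mul_of_nonneg_right h3 hE.le
  nlinarith [mul_nonneg hQ0 hE.le]

end IsAmplitudePair


/-! ### Matrix exponentials and time averages. -/

theorem hasDerivAt_exp_smul_mulVec {ι : Type*} [Fintype ι] [DecidableEq ι] (M : Matrix ι ι ℝ)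
    (v : ι → ℝ) (p : ι) (t : ℝ) :
    HasDerivAt (fun s : ℝ => (NormedSpace.exp (s • M) *ᵥ v) p)
      ((M *ᵥ (NormedSpace.exp (t • M) *ᵥ v)) p) t := by
  open scoped Matrix.Norms.Operator in
  have h : HasDerivAt (fun s : ℝ => NormedSpace.exp (s • M)) (M * NormedSpace.exp (t • M)) t :=
    hasDerivAt_exp_smul_const' M t
  let φ : Matrix ι ι ℝ →ₗ[ℝ] ℝ :=
    { toFun := fun X => (X *ᵥ v) p
      map_add' := fun X Y => by simp [Matrix.add_mulVec]
      map_smul' := fun r X => by simp [Matrix.smul_mulVec] }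
  have h2 := (φ.toContinuousLinearMap.hasFDerivAt (x := NormedSpace.exp (t • M))).comp_hasDerivAt t h
  have e : φ.toContinuousLinearMap (M * NormedSpace.exp (t • M)) =
      (M *ᵥ (NormedSpace.exp (t • M) *ᵥ v)) p := by
    rw [Matrix.mulVec_mulVec]; rfl
  exact h2.congr_deriv e

open Filter Topology in
theorem tendsto_average_of_hasDerivAt {f F : ℝ → ℝ} {l M : ℝ} (hf : Continuous f)
    (hF : ∀ t, HasDerivAt F (f t - l) t) (hM : ∀ t, |F t| ≤ M) :
    Tendsto (fun T : ℝ => 1 / T * ∫ τ in (0 : ℝ)..T, f τ) atTop (𝓝 l) := by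
  have hint : ∀ T : ℝ, ∫ τ in (0 : ℝ)..T, f τ = l * T + (F T - F 0) := fun T => by
    have h := intervalIntegral.integral_eq_sub_of_hasDerivAt (a := 0) (b := T) (fun t _ => hF t)
      ((hf.sub continuous_const).intervalIntegrable _ _)
    rw [intervalIntegral.integral_sub (hf.intervalIntegrable _ _) (by simp)] at h
    simp at h
    linarith
  have h0 : Tendsto (fun T : ℝ => l + 1 / T * (F T - F 0)) atTop (𝓝 (l + 0)) := by
    refine tendsto_const_nhds.add ?_
    refine squeeze_zero_norm' (a := fun T : ℝ => (M + M) * T⁻¹) ?_ ?_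
    · filter_upwards [eventually_gt_atTop 0] with T hT
      rw [Real.norm_eq_abs, abs_mul, one_div, abs_of_pos (inv_pos.2 hT), mul_comm]
      gcongr
      exact (abs_sub _ _).trans (add_le_add (hM _) (hM _))
    · simpa using tendsto_inv_atTop_zero.const_mul (M + M)
  rw [add_zero] at h0
  refine h0.congr' ?_
  filter_upwards [eventually_gt_atTop 0] with T hT
  rw [hint]
  field_simp

open Filter Topology Real in
theorem tendsto_average_cos_two_mul {ω : ℝ} (hω : 0 < ω) (a b d : ℝ) :
    Tendsto (fun T : ℝ => 1 / T * ∫ τ in (0 : ℝ)..T, cos (2 * ω * τ) * (a * cos (ω * τ) ^ 2 +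
      b * sin (ω * τ) ^ 2 + 2 * d * (sin (ω * τ) * cos (ω * τ)))) atTop (𝓝 ((a - b) / 4)) := by
  refine tendsto_average_of_hasDerivAt (F := fun t => (a + b) / (4 * ω) * sin (2 * ω * t) +
    (a - b) / (16 * ω) * sin (4 * ω * t) - d / (8 * ω) * cos (4 * ω * t))
    (M := |(a + b) / (4 * ω)| + |(a - b) / (16 * ω)| + |d / (8 * ω)|)
    (by fun_prop) (fun t => ?_) (fun t => ?_)
  · have h2 := ((hasDerivAt_id t).const_mul (2 * ω)).sin.const_mul ((a + b) / (4 * ω))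
    have h4 := ((hasDerivAt_id t).const_mul (4 * ω)).sin.const_mul ((a - b) / (16 * ω))
    have h4' := ((hasDerivAt_id t).const_mul (4 * ω)).cos.const_mul (d / (8 * ω))
    refine ((h2.add h4).sub h4').congr_deriv ?_
    simp only [id]
    have hc2 : cos (2 * ω * t) = 1 - 2 * sin (ω * t) ^ 2 := by
      rw [mul_assoc, cos_two_mul, cos_sq']; ring
    have hc4 : cos (4 * ω * t) = 2 * cos (2 * ω * t) ^ 2 - 1 := by
      rw [← cos_two_mul]; ring_nf
    have hs2 : sin (2 * ω * t) = 2 * sin (ω * t) * cos (ω * t) := by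
      rw [mul_assoc, sin_two_mul]
    have hs4 : sin (4 * ω * t) = 2 * sin (2 * ω * t) * cos (2 * ω * t) := by
      rw [← sin_two_mul]; ring_nf
    have hcc : cos (ω * t) ^ 2 = 1 - sin (ω * t) ^ 2 := cos_sq' _
    rw [hs4, hc4, hs2, hc2, hcc]
    field_simp
    ring
  · refine (abs_sub _ _).trans (add_le_add ((abs_add_le _ _).trans (add_le_add ?_ ?_)) ?_) <;>
      rw [abs_mul] <;> refine mul_le_of_le_one_right (abs_nonneg _) ?_
    · exact abs_sin_le_one _
    · exact abs_sin_le_one _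
    · exact abs_cos_le_one _

open Filter in
theorem not_forall_mul_exp_le {r k M : ℝ} (hr : 0 < r) (hk : 0 < k) :
    ¬ ∀ t : ℝ, 0 ≤ t → k * Real.exp (r * t) ≤ M := by
  intro h
  have := h (|M| / (k * r)) (by positivity)
  have h2 := Real.add_one_le_exp (r * (|M| / (k * r)))
  have h3 : r * (|M| / (k * r)) = |M| / k := by field_simp
  rw [h3] at h2 this
  have h4 : k * (|M| / k + 1) ≤ M := (mul_le_mul_of_nonneg_left h2 hk.le).trans this
  have h5 : k * (|M| / k + 1) = |M| + k := by field_simp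
  linarith [le_abs_self M]

/-! ### Splitting into total current and deviations. -/

namespace CoupledRLC

variable {c : CoupledRLC}

/-- The total current through the shared capacitor. -/
noncomputable def totalCurrent (y : Fin c.n × Fin 2 → ℝ) : ℝ := ∑ i, y (i, 0)

/-- The component of the state that is in quadrature with the total current. -/
noncomputable def quadrature (y : Fin c.n × Fin 2 → ℝ) : ℝ :=
  (∑ i, y (i, 1) + c.γ / 2 * ∑ i, y (i, 0)) / c.ω

/-- The energy of the deviation of the `i`-th circuit from the mean. -/
noncomputable def deviationEnergy (i : Fin c.n) (y : Fin c.n × Fin 2 → ℝ) : ℝ :=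
  (y (i, 1) - (∑ j, y (j, 1)) / c.n) ^ 2 +
    1 / (c.L * c.C) * (y (i, 0) - (∑ j, y (j, 0)) / c.n) ^ 2

/-- The equations of `n` damped oscillators, coupled through their sum with modulation `k`. -/
def IsModulated (c : CoupledRLC) (k : ℝ → ℝ) (y : ℝ → Fin c.n × Fin 2 → ℝ) : Prop :=
  ∀ i : Fin c.n, ∀ t : ℝ, 0 ≤ t →
    HasDerivWithinAt (fun s => y s (i, 0)) (y t (i, 1)) (Set.Ici 0) t ∧
    HasDerivWithinAt (fun s => y s (i, 1))
      (-(1 / (c.L * c.C)) * y t (i, 0) - c.γ * y t (i, 1) - k t * ∑ j, y t (j, 0)) (Set.Ici 0) t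

theorem n_cast_pos (c : CoupledRLC) : (0 : ℝ) < c.n := Nat.cast_pos.2 c.n_pos

theorem γ_nonneg (c : CoupledRLC) : 0 ≤ c.γ := div_nonneg c.R_nonneg c.L_pos.le

theorem ε_pos (c : CoupledRLC) : 0 < c.ε := div_pos c.η_pos (mul_pos c.L_pos c.Cbar_pos)

theorem ω_pos (h : 0 < c.omegaSq) : 0 < c.ω := Real.sqrt_pos.2 h

theorem sq_ω (h : 0 < c.omegaSq) : c.ω ^ 2 = c.omegaSq := Real.sq_sqrt h.le

theorem IsModulated.hasDerivWithinAt_sum_zero {k : ℝ → ℝ} {y : ℝ → Fin c.n × Fin 2 → ℝ}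
    (h : c.IsModulated k y) {t : ℝ} (ht : 0 ≤ t) :
    HasDerivWithinAt (fun s => ∑ i, y s (i, 0)) (∑ i, y t (i, 1)) (Set.Ici 0) t :=
  HasDerivWithinAt.fun_sum fun i _ => (h i t ht).1

theorem IsModulated.hasDerivWithinAt_sum_one {k : ℝ → ℝ} {y : ℝ → Fin c.n × Fin 2 → ℝ}
    (h : c.IsModulated k y) {t : ℝ} (ht : 0 ≤ t) :
    HasDerivWithinAt (fun s => ∑ i, y s (i, 1))
      (-(1 / (c.L * c.C)) * ∑ i, y t (i, 0) - c.γ * ∑ i, y t (i, 1)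
        - c.n * k t * ∑ i, y t (i, 0)) (Set.Ici 0) t := by
  refine (HasDerivWithinAt.fun_sum fun i _ => (h i t ht).2).congr_deriv ?_
  rw [Finset.sum_sub_distrib, Finset.sum_sub_distrib, ← Finset.mul_sum, ← Finset.mul_sum,
    Finset.sum_const, Finset.card_univ, Fintype.card_fin, nsmul_eq_mul, mul_assoc]

/-- The modulated term is the same in every circuit, so it cancels on subtracting the mean; what
remains loses energy at the rate `2γ` times the squared velocity deviation. -/
theorem IsModulated.deviationEnergy_le {k : ℝ → ℝ} {y : ℝ → Fin c.n × Fin 2 → ℝ}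
    (h : c.IsModulated k y) (i : Fin c.n) {t : ℝ} (ht : 0 ≤ t) :
    c.deviationEnergy i (y t) ≤ c.deviationEnergy i (y 0) := by
  have hd : ∀ t, 0 ≤ t → ∃ f', HasDerivWithinAt (fun s => c.deviationEnergy i (y s)) f'
      (Set.Ici 0) t ∧ f' ≤ 0 * c.deviationEnergy i (y t) := fun t ht => by
    obtain ⟨h0, h1⟩ := h i t ht
    have d0 := h0.sub ((h.hasDerivWithinAt_sum_zero ht).div_const c.n)
    have d1 := h1.sub ((h.hasDerivWithinAt_sum_one ht).div_const c.n)
    refine ⟨_, (d1.pow 2).add ((d0.pow 2).const_mul (1 / (c.L * c.C))), ?_⟩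
    have hn := c.n_cast_pos.ne'
    rw [zero_mul]
    refine le_of_eq_of_le (b := -(2 * c.γ * (y t (i, 1) - (∑ j, y t (j, 1)) / c.n) ^ 2)) ?_ ?_
    · simp only [Pi.sub_apply]
      generalize ∑ j, y t (j, 0) = S
      generalize ∑ j, y t (j, 1) = T
      generalize 1 / (c.L * c.C) = w
      simp only [Nat.cast_ofNat, Nat.add_one_sub_one, pow_one]
      field_simp
      ring
    · have := c.γ_nonneg
      have : 0 ≤ 2 * c.γ * (y t (i, 1) - (∑ j, y t (j, 1)) / c.n) ^ 2 := by positivity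
      linarith
  choose! f' hf' hle using hd
  simpa using le_mul_exp_of_hasDerivWithinAt_le hf' hle ht

-- The tuning of `ω` is exactly what makes the unmodulated part of the `(S, V)` system a damped
-- rotation at frequency `ω`; passing to the rotating frame then leaves only the modulation.
open Real in
theorem IsModulated.isAmplitudePair {k m : ℝ → ℝ} {y : ℝ → Fin c.n × Fin 2 → ℝ}
    (h : c.IsModulated k y) (hω : 0 < c.omegaSq)
    (hk : ∀ t, 0 ≤ t → k t = 1 / (c.L * c.Cbar) + c.ε * m t) :
    IsAmplitudePair c.ω (c.ε * (c.n / c.ω)) m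
      (fun t => exp (c.γ / 2 * t) *
        (c.totalCurrent (y t) * cos (c.ω * t) - c.quadrature (y t) * sin (c.ω * t)))
      (fun t => exp (c.γ / 2 * t) *
        (c.totalCurrent (y t) * sin (c.ω * t) + c.quadrature (y t) * cos (c.ω * t))) := by
  have hω0 := ω_pos hω
  have hsq := sq_ω hω
  have de : ∀ t, HasDerivWithinAt (fun t => exp (c.γ / 2 * t))
      (exp (c.γ / 2 * t) * (c.γ / 2 * 1)) (Set.Ici 0) t := fun t =>
    ((hasDerivAt_id t).const_mul (c.γ / 2)).exp.hasDerivWithinAt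
  have ds : ∀ t, HasDerivWithinAt (fun t => sin (c.ω * t))
      (cos (c.ω * t) * (c.ω * 1)) (Set.Ici 0) t := fun t =>
    ((hasDerivAt_id t).const_mul c.ω).sin.hasDerivWithinAt
  have dc : ∀ t, HasDerivWithinAt (fun t => cos (c.ω * t))
      (-sin (c.ω * t) * (c.ω * 1)) (Set.Ici 0) t := fun t =>
    ((hasDerivAt_id t).const_mul c.ω).cos.hasDerivWithinAt
  have dS : ∀ t, 0 ≤ t → HasDerivWithinAt (fun t => c.totalCurrent (y t))
      (c.ω * c.quadrature (y t) - c.γ / 2 * c.totalCurrent (y t)) (Set.Ici 0) t := fun t ht => by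
    refine (h.hasDerivWithinAt_sum_zero ht).congr_deriv ?_
    rw [quadrature, totalCurrent]
    field_simp
    ring
  have dV : ∀ t, 0 ≤ t → HasDerivWithinAt (fun t => c.quadrature (y t))
      (-(c.ω + c.ε * (c.n / c.ω) * m t) * c.totalCurrent (y t) - c.γ / 2 * c.quadrature (y t))
      (Set.Ici 0) t := fun t ht => by
    refine (((h.hasDerivWithinAt_sum_one ht).add
      ((h.hasDerivWithinAt_sum_zero ht).const_mul (c.γ / 2))).div_const c.ω).congr_deriv ?_
    rw [quadrature, totalCurrent, hk t ht]
    generalize ∑ j, y t (j, 0) = S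
    generalize ∑ j, y t (j, 1) = T
    rw [div_eq_iff hω0.ne']
    have hinv := mul_inv_cancel₀ hω0.ne'
    rw [omegaSq] at hsq
    linear_combination S * hsq +
      (c.ε * c.n * m t * S + c.γ / 2 * (T + c.γ / 2 * S)) * hinv
  constructor
  · intro t ht
    refine ((de t).mul (((dS t ht).mul (dc t)).sub ((dV t ht).mul (ds t)))).congr_deriv ?_
    simp only [Pi.sub_apply, Pi.mul_apply]
    linear_combination (-exp (c.γ / 2 * t) * c.ε * (c.n / c.ω) * m t * sin (c.ω * t) *
      c.totalCurrent (y t)) * sin_sq_add_cos_sq (c.ω * t)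
  · intro t ht
    refine ((de t).mul (((dS t ht).mul (ds t)).add ((dV t ht).mul (dc t)))).congr_deriv ?_
    simp only [Pi.add_apply, Pi.mul_apply]
    linear_combination (exp (c.γ / 2 * t) * c.ε * (c.n / c.ω) * m t * cos (c.ω * t) *
      c.totalCurrent (y t)) * sin_sq_add_cos_sq (c.ω * t)

open Real in
theorem amplitude_sq_add_sq (y : Fin c.n × Fin 2 → ℝ) (t : ℝ) :
    (exp (c.γ / 2 * t) *
        (c.totalCurrent y * cos (c.ω * t) - c.quadrature y * sin (c.ω * t))) ^ 2 +
      (exp (c.γ / 2 * t) *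
        (c.totalCurrent y * sin (c.ω * t) + c.quadrature y * cos (c.ω * t))) ^ 2 =
    exp (c.γ * t) * (c.totalCurrent y ^ 2 + c.quadrature y ^ 2) := by
  have e : exp (c.γ * t) = exp (c.γ / 2 * t) ^ 2 := by
    rw [sq, ← exp_add]; ring_nf
  rw [e]
  linear_combination exp (c.γ / 2 * t) ^ 2 * (c.totalCurrent y ^ 2 + c.quadrature y ^ 2) *
    sin_sq_add_cos_sq (c.ω * t)

theorem exists_totalCurrent_sq_add_quadrature_sq_le (c : CoupledRLC) (M : ℝ) :
    ∃ K, ∀ x : c.State, ‖x‖ ≤ M → c.totalCurrent x.ofLp ^ 2 + c.quadrature x.ofLp ^ 2 ≤ K := by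
  refine ⟨(c.n * M) ^ 2 + ((c.n * M + c.γ / 2 * (c.n * M)) / |c.ω|) ^ 2, fun x hx => ?_⟩
  have hb : ∀ k : Fin 2, |∑ i, x.ofLp (i, k)| ≤ c.n * M := fun k => by
    refine (Finset.abs_sum_le_sum_abs _ _).trans ?_
    refine (Finset.sum_le_card_nsmul _ _ M fun i _ => ?_).trans_eq (by simp)
    exact (PiLp.norm_apply_le x (i, k)).trans hx
  have hγ := c.γ_nonneg
  refine add_le_add (sq_le_sq' (neg_le_of_abs_le (hb 0)) (le_of_abs_le (hb 0))) ?_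
  rw [← sq_abs (c.quadrature x.ofLp)]
  refine pow_le_pow_left₀ (abs_nonneg _) ?_ 2
  rw [quadrature, abs_div]
  gcongr
  refine (abs_add_le _ _).trans (add_le_add (hb 1) ?_)
  rw [abs_mul, abs_of_nonneg (by positivity : 0 ≤ c.γ / 2)]
  gcongr
  exact hb 0

theorem exists_norm_le (hω : 0 < c.omegaSq) (K : ℝ) (N : Fin c.n → ℝ) :
    ∃ M, ∀ x : c.State, c.totalCurrent x.ofLp ^ 2 + c.quadrature x.ofLp ^ 2 ≤ K →
      (∀ i, c.deviationEnergy i x.ofLp ≤ N i) → ‖x‖ ≤ M := by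
  have hω0 := ω_pos hω
  have hLC : 0 < 1 / (c.L * c.C) := one_div_pos.2 (mul_pos c.L_pos c.C_pos)
  have hγ := c.γ_nonneg
  have hn := c.n_cast_pos
  set bS := √K
  set bT := c.ω * √K + c.γ / 2 * √K
  set B : Fin c.n × Fin 2 → ℝ := fun p =>
    if p.2 = 0 then √(N p.1 / (1 / (c.L * c.C))) + bS / c.n else √(N p.1) + bT / c.n with hB
  refine ⟨√(∑ p, B p ^ 2), fun x hK hN => ?_⟩
  have hS : |∑ i, x.ofLp (i, 0)| ≤ bS := Real.abs_le_sqrt (by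
    have := sq_nonneg (c.quadrature x.ofLp)
    rw [totalCurrent] at hK; linarith)
  have hV : |c.quadrature x.ofLp| ≤ √K := Real.abs_le_sqrt (by
    have := sq_nonneg (c.totalCurrent x.ofLp); linarith)
  have hT : |∑ i, x.ofLp (i, 1)| ≤ bT := by
    have e : ∑ i, x.ofLp (i, 1) = c.ω * c.quadrature x.ofLp - c.γ / 2 * ∑ i, x.ofLp (i, 0) := by
      rw [quadrature]; field_simp; ring
    rw [e]
    refine (abs_sub _ _).trans ?_
    rw [abs_mul, abs_mul, abs_of_pos hω0, abs_of_nonneg (by positivity : 0 ≤ c.γ / 2)]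
    exact add_le_add (mul_le_mul_of_nonneg_left hV hω0.le)
      (mul_le_mul_of_nonneg_left hS (by positivity))
  have hx : ∀ p, |x.ofLp p| ≤ B p := by
    rintro ⟨i, k⟩
    have hE := hN i
    rw [deviationEnergy] at hE
    obtain rfl | rfl : k = 0 ∨ k = 1 := by omega
    · have h1 : |x.ofLp (i, 0) - (∑ j, x.ofLp (j, 0)) / c.n| ≤ √(N i / (1 / (c.L * c.C))) := by
        refine Real.abs_le_sqrt ?_
        rw [le_div_iff₀ hLC, mul_comm]
        nlinarith [sq_nonneg (x.ofLp (i, 1) - (∑ j, x.ofLp (j, 1)) / c.n)]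
      have h2 : |(∑ j, x.ofLp (j, 0)) / c.n| ≤ bS / c.n := by
        rw [abs_div, abs_of_pos hn]; gcongr
      have h3 := abs_sub_abs_le_abs_sub (x.ofLp (i, 0)) ((∑ j, x.ofLp (j, 0)) / c.n)
      have h4 : B (i, 0) = √(N i / (1 / (c.L * c.C))) + bS / c.n := if_pos rfl
      linarith
    · have h1 : |x.ofLp (i, 1) - (∑ j, x.ofLp (j, 1)) / c.n| ≤ √(N i) := by
        refine Real.abs_le_sqrt ?_
        have := mul_nonneg hLC.le (sq_nonneg (x.ofLp (i, 0) - (∑ j, x.ofLp (j, 0)) / c.n))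
        linarith
      have h2 : |(∑ j, x.ofLp (j, 1)) / c.n| ≤ bT / c.n := by
        rw [abs_div, abs_of_pos hn]; gcongr
      have h3 := abs_sub_abs_le_abs_sub (x.ofLp (i, 1)) ((∑ j, x.ofLp (j, 1)) / c.n)
      have h4 : B (i, 1) = √(N i) + bT / c.n := if_neg (by simp)
      linarith
  rw [EuclideanSpace.norm_eq]
  refine Real.sqrt_le_sqrt (Finset.sum_le_sum fun p _ => ?_)
  exact pow_le_pow_left₀ (norm_nonneg _) (hx p) 2

/-- Neither existence nor uniqueness of trajectories is needed: the subspace collects initial values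
admitting some bounded trajectory in `Sol`, and a proper subspace lies in the kernel of a nonzero
functional. -/
theorem exists_hyperplane (Sol : Submodule ℝ (ℝ → c.State)) {p : Prop}
    (hp : p → ∃ v, ∀ x ∈ Sol, x 0 = v → c.IsUnbounded x)
    (hnp : ¬ p → ∀ x ∈ Sol, ¬ c.IsUnbounded x) :
    ∃ E : Submodule ℝ c.State, Module.finrank ℝ E = 2 * c.n - 1 ∧
      ∀ x ∈ Sol, x 0 ∉ E → (c.IsUnbounded x ↔ p) := by
  have hdim : Module.finrank ℝ c.State = 2 * c.n := by simp [mul_comm]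
  have key : ∀ V : Submodule ℝ c.State, V ≠ ⊤ → ∃ E : Submodule ℝ c.State,
      V ≤ E ∧ Module.finrank ℝ E = 2 * c.n - 1 := fun V hV => by
    obtain ⟨f, hf, hle⟩ := V.exists_le_ker_of_lt_top (lt_top_iff_ne_top.2 hV)
    have := Module.Dual.finrank_ker_add_one_of_ne_zero hf
    exact ⟨_, hle, by omega⟩
  by_cases h : p
  · let V : Submodule ℝ c.State :=
      { carrier := {v | ∃ x ∈ Sol, x 0 = v ∧ ¬ c.IsUnbounded x}
        zero_mem' := ⟨0, Sol.zero_mem, rfl, not_not.2 ⟨0, by simp⟩⟩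
        add_mem' := by
          rintro _ _ ⟨x, hx, rfl, hxb⟩ ⟨y, hy, rfl, hyb⟩
          obtain ⟨M, hM⟩ := not_not.1 hxb
          obtain ⟨N, hN⟩ := not_not.1 hyb
          exact ⟨x + y, Sol.add_mem hx hy, rfl, not_not.2 ⟨M + N, fun t ht =>
            (norm_add_le _ _).trans (add_le_add (hM t ht) (hN t ht))⟩⟩
        smul_mem' := by
          rintro r _ ⟨x, hx, rfl, hxb⟩
          obtain ⟨M, hM⟩ := not_not.1 hxb
          refine ⟨r • x, Sol.smul_mem r hx, rfl, not_not.2 ⟨|r| * M, fun t ht => ?_⟩⟩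
          rw [Pi.smul_apply, norm_smul]
          exact mul_le_mul_of_nonneg_left (hM t ht) (abs_nonneg r) }
    obtain ⟨v, hv⟩ := hp h
    have hV : V ≠ ⊤ := fun hV => by
      obtain ⟨x, hx, hxv, hxb⟩ : v ∈ V := hV ▸ Submodule.mem_top
      exact hxb (hv x hx hxv)
    obtain ⟨E, hVE, hE⟩ := key V hV
    exact ⟨E, hE, fun x hx hxE => ⟨fun _ => h, fun _ => by_contra fun hxb =>
      hxE (hVE ⟨x, hx, rfl, hxb⟩)⟩⟩
  -- All trajectories are bounded here, so any hyperplane serves; `n ≥ 1` makes the state space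
  -- nonzero.
  · have : Nonempty (Fin c.n × Fin 2) := ⟨(⟨0, c.n_pos⟩, 0)⟩
    obtain ⟨E, -, hE⟩ := key ⊥ bot_ne_top
    exact ⟨E, hE, fun x hx _ => ⟨fun hb => (hnp h x hx hb).elim, fun hp => (h hp).elim⟩⟩

/-- The linear space of the trajectories with modulation `k`. -/
def modulatedSolutions (c : CoupledRLC) (k : ℝ → ℝ) : Submodule ℝ (ℝ → c.State) where
  carrier := {x | c.IsModulated k fun t => (x t).ofLp}
  zero_mem' := fun i t _ => by
    refine ⟨(hasDerivWithinAt_const t (Set.Ici 0) (0 : ℝ)).congr_deriv ?_,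
      (hasDerivWithinAt_const t (Set.Ici 0) (0 : ℝ)).congr_deriv ?_⟩ <;> simp
  add_mem' := fun {x y} hx hy i t ht => by
    refine ⟨((hx i t ht).1.add (hy i t ht).1).congr_deriv ?_,
      ((hx i t ht).2.add (hy i t ht).2).congr_deriv ?_⟩
    · simp
    · simp [Finset.sum_add_distrib]; ring
  smul_mem' := fun r x hx i t ht => by
    refine ⟨((hx i t ht).1.const_mul r).congr_deriv ?_,
      ((hx i t ht).2.const_mul r).congr_deriv ?_⟩
    · simp
    · simp [← Finset.mul_sum]; ring

end CoupledRLC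


/-! ### The criterion for true solutions. -/

namespace CoupledRLC

variable {c : CoupledRLC}

open Real in
theorem exists_hyperplane_modulatedSolutions (hω : 0 < c.omegaSq) {k m : ℝ → ℝ} {θ : ℝ}
    (hθ : 0 < θ) (hθ' : θ ≤ 1 / 2)
    (hk : ∀ t, 0 ≤ t → k t = 1 / (c.L * c.Cbar) + c.ε * m t)
    (hm : ∀ t, 0 ≤ t → |m t - cos (2 * (c.ω * t))| ≤ 2 * (θ / 100))
    (hsmall : c.ε * c.n ≤ θ / 100 * c.ω ^ 2)
    (hgap : θ * (2 * c.γ) ≤ |c.ε * (c.n / c.ω) - 2 * c.γ|) :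
    ∃ E : Submodule ℝ c.State, Module.finrank ℝ E = 2 * c.n - 1 ∧
      ∀ x ∈ c.modulatedSolutions k, x 0 ∉ E →
        (c.IsUnbounded x ↔ c.ε * (c.n / c.ω) > 2 * c.γ) := by
  have hω0 := ω_pos hω
  have hγ := c.γ_nonneg
  have hn := c.n_cast_pos
  have hμ : 0 < c.ε * (c.n / c.ω) := mul_pos c.ε_pos (div_pos hn hω0)
  have hμδ : c.ε * (c.n / c.ω) ≤ θ / 100 * c.ω := by
    rw [← mul_div_assoc, div_le_iff₀ hω0]
    linarith
  set μ := c.ε * (c.n / c.ω) with hμdef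
  refine c.exists_hyperplane _ (fun hp => ?_) (fun hnp x hx => ?_)
  -- This state has `S = 1` and `V = -1`, that is `a = 1`, `b = -1`: the growing direction.
  · refine ⟨WithLp.toLp 2 fun p => if p.2 = 0 then 1 / c.n else (-c.ω - c.γ / 2) / c.n,
      fun x hx hxv ⟨M, hM⟩ => ?_⟩
    obtain ⟨K, hK⟩ := c.exists_totalCurrent_sq_add_quadrature_sq_le M
    have hpair := IsModulated.isAmplitudePair hx hω hk
    have h0 : c.totalCurrent (x 0).ofLp = 1 := by
      rw [hxv, totalCurrent]; simp [hn.ne']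
    have h1 : c.quadrature (x 0).ofLp = -1 := by
      rw [hxv, quadrature]; simp; field_simp; ring
    refine not_forall_mul_exp_le (r := μ / 2 * (1 - 19 * (θ / 100)) - c.γ) (k := 1) (M := K)
      ?_ one_pos fun t ht => ?_
    -- The gap reads `μ ≥ 2(1 + θ)γ`, and `(1 + θ)(1 - 19θ/100) > 1` for `0 < θ ≤ 1/2`, so the net
    -- rate is positive.
    · rw [abs_of_pos (by linarith)] at hgap
      have : 0 < (1 + θ) * (μ / 2 * (1 - 19 * (θ / 100)) - c.γ) := by
        have : 0 < μ * θ * (81 / 100 - 19 / 100 * θ) := by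
          have : 0 < 81 / 100 - 19 / 100 * θ := by linarith
          positivity
        linarith
      exact pos_of_mul_pos_right this (by linarith)
    · have h := hpair.exp_le_sq_add_sq hω0 hμ.le (by linarith) hμδ hm (by simp [h0])
        (by simp [h1]) ht
      rw [c.amplitude_sq_add_sq] at h
      have hle : exp (μ / 2 * (1 - 19 * (θ / 100)) * t) ≤ exp (c.γ * t) * K :=
        h.trans (mul_le_mul_of_nonneg_left (hK _ (hM t ht)) (exp_pos _).le)
      rw [one_mul, sub_mul, exp_sub, div_le_iff₀ (exp_pos _), mul_comm K]
      exact hle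
  · rw [abs_of_nonpos (by linarith)] at hgap
    have hpair := IsModulated.isAmplitudePair hx hω hk
    obtain ⟨M, hM⟩ := exists_norm_le hω
      (2 * (c.totalCurrent (x 0).ofLp ^ 2 + c.quadrature (x 0).ofLp ^ 2))
      (fun i => c.deviationEnergy i (x 0).ofLp)
    refine not_not.2 ⟨M, fun t ht => hM _ ?_ fun i => IsModulated.deviationEnergy_le hx i ht⟩
    have h := hpair.sq_add_sq_le_exp hω0 hμ.le (by linarith) hμδ hm ht
    rw [c.amplitude_sq_add_sq, c.amplitude_sq_add_sq, mul_zero, exp_zero, one_mul] at h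
    have hrate : μ / 2 * (1 + 13 * (θ / 100)) * t ≤ c.γ * t := by
      refine mul_le_mul_of_nonneg_right ?_ ht
      -- The gap reads `μ/2 ≤ (1 - θ)γ`, and `(1 - θ)(1 + 13θ/100) ≤ 1`, so damping wins.
      have h1 : μ / 2 * (1 + 13 * (θ / 100)) ≤ c.γ * (1 - θ) * (1 + 13 * (θ / 100)) := by
        gcongr
        linarith
      have : 0 ≤ c.γ * θ := by positivity
      have : 0 ≤ c.γ * θ * θ := by positivity
      linarith
    have h2 := h.trans (mul_le_mul_of_nonneg_left (exp_le_exp.2 hrate) (by positivity))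
    rw [mul_comm] at h2
    exact le_of_mul_le_mul_right h2 (exp_pos _)

theorem A_mulVec_zero (y : Fin c.n × Fin 2 → ℝ) (i : Fin c.n) :
    (c.A *ᵥ y) (i, 0) = y (i, 1) := by
  simp only [Matrix.mulVec, dotProduct, Fintype.sum_prod_type, Fin.sum_univ_two, A, Matrix.of_apply]
  simp [diagBlock, offBlock, ite_mul, apply_ite]

theorem A_mulVec_one (y : Fin c.n × Fin 2 → ℝ) (i : Fin c.n) :
    (c.A *ᵥ y) (i, 1) = -(1 / (c.L * c.C)) * y (i, 0) - c.γ * y (i, 1)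
      - 1 / (c.L * c.Cbar) * ∑ j, y (j, 0) := by
  have h : ∀ j : Fin c.n, (∑ l, c.A (i, 1) (j, l) * y (j, l)) =
      (if i = j then -(1 / (c.L * c.C)) * y (j, 0) - c.γ * y (j, 1) else 0) -
        1 / (c.L * c.Cbar) * y (j, 0) := fun j => by
    rw [Fin.sum_univ_two]
    by_cases hij : i = j
    · simp [A, hij, diagBlock, offBlock, γ]
      ring
    · simp [A, hij, diagBlock, offBlock]
  simp only [Matrix.mulVec, dotProduct, Fintype.sum_prod_type]
  simp only [h]
  rw [Finset.sum_sub_distrib, ← Finset.mul_sum]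
  simp

theorem P_mulVec (t : ℝ) (y : Fin c.n × Fin 2 → ℝ) (i : Fin c.n) :
    (c.P t *ᵥ y) (i, 0) = 0 ∧
      (c.P t *ᵥ y) (i, 1) = -Real.cos (2 * c.ω * t) * ∑ j, y (j, 0) := by
  constructor <;> simp only [Matrix.mulVec, dotProduct, Fintype.sum_prod_type, Fin.sum_univ_two, P,
    Matrix.of_apply] <;> simp [forcingBlock, Finset.mul_sum]

theorem IsFirstOrderSolution.mem_modulatedSolutions {x : ℝ → c.State}
    (hx : c.IsFirstOrderSolution x) :
    x ∈ c.modulatedSolutions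
      fun t => 1 / (c.L * c.Cbar) + c.ε * Real.cos (2 * (c.ω * t)) := by
  intro i t ht
  have h : ∀ p, HasDerivWithinAt (fun s => x s p) (((c.A + c.ε • c.P t) *ᵥ (x t).ofLp) p)
      (Set.Ici 0) t := fun p =>
    ((EuclideanSpace.proj p : c.State →L[ℝ] ℝ).hasFDerivAt).comp_hasDerivWithinAt t (hx t ht)
  simp only [Matrix.add_mulVec, Matrix.smul_mulVec, Pi.add_apply, Pi.smul_apply, smul_eq_mul] at h
  refine ⟨(h (i, 0)).congr_deriv ?_, (h (i, 1)).congr_deriv ?_⟩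
  · rw [A_mulVec_zero, (P_mulVec t _ i).1]; ring
  · rw [A_mulVec_one, (P_mulVec t _ i).2, mul_assoc 2]; ring

theorem IsCircuitSolution.mem_modulatedSolutions {x : ℝ → c.State}
    (hx : c.IsCircuitSolution x) :
    x ∈ c.modulatedSolutions fun t => 1 / (c.L * c.sharedCapacitance t) := by
  intro i t ht
  refine ⟨hx.current i t ht, ?_⟩
  obtain ⟨d, hd, h⟩ := hx.kirchhoff i t ht
  refine hd.congr_deriv ?_
  have hL := c.L_pos.ne'
  have e : d = (c.L * d) / c.L := by field_simp
  have e2 : c.L * d = -(1 / c.sharedCapacitance t * ∑ j, x t (j, 0)) - 1 / c.C * x t (i, 0)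
    - c.R * x t (i, 1) := by linarith
  rw [e, e2, γ]
  simp only [one_div, mul_inv]
  ring

theorem sharedCapacitance_modulation (hη : c.η ≤ 1 / 2) (t : ℝ) :
    ∃ m, 1 / (c.L * c.sharedCapacitance t) = 1 / (c.L * c.Cbar) + c.ε * m ∧
      |m - Real.cos (2 * (c.ω * t))| ≤ 2 * c.η := by
  have hη0 := c.η_pos
  have hL := c.L_pos.ne'
  have hC := c.Cbar_pos.ne'
  rw [sharedCapacitance, ε, mul_assoc 2]
  have h1 := Real.cos_le_one (2 * (c.ω * t))
  have h2 := Real.neg_one_le_cos (2 * (c.ω * t))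
  generalize Real.cos (2 * (c.ω * t)) = x at *
  have hpos : 1 / 2 ≤ 1 - c.η * x := by nlinarith
  have hne : 1 - c.η * x ≠ 0 := by linarith
  refine ⟨x / (1 - c.η * x), ?_, ?_⟩
  · field_simp
    ring
  · have e : x / (1 - c.η * x) - x = c.η * x ^ 2 / (1 - c.η * x) := by
      rw [div_sub' hne]
      ring
    have hx2 : x ^ 2 ≤ 1 := by nlinarith
    rw [e, abs_of_nonneg (by positivity), div_le_iff₀ (by linarith)]
    nlinarith

/-! ### The flow of `A` and the effective matrix. -/

theorem isModulated_exp_smul_A (v : Fin c.n × Fin 2 → ℝ) :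
    c.IsModulated (fun _ => 1 / (c.L * c.Cbar)) fun t => NormedSpace.exp (t • c.A) *ᵥ v :=
  fun i t _ =>
    ⟨(hasDerivAt_exp_smul_mulVec c.A v (i, 0) t).hasDerivWithinAt.congr_deriv (A_mulVec_zero _ i),
      (hasDerivAt_exp_smul_mulVec c.A v (i, 1) t).hasDerivWithinAt.congr_deriv (A_mulVec_one _ i)⟩

open Real in
theorem totalCurrent_exp_smul_A (hω : 0 < c.omegaSq) (v : Fin c.n × Fin 2 → ℝ) {t : ℝ}
    (ht : 0 ≤ t) :
    exp (c.γ / 2 * t) * c.totalCurrent (NormedSpace.exp (t • c.A) *ᵥ v) =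
        c.totalCurrent v * cos (c.ω * t) + c.quadrature v * sin (c.ω * t) ∧
      exp (c.γ / 2 * t) * c.quadrature (NormedSpace.exp (t • c.A) *ᵥ v) =
        -c.totalCurrent v * sin (c.ω * t) + c.quadrature v * cos (c.ω * t) := by
  have h := (isModulated_exp_smul_A v).isAmplitudePair hω (m := fun _ => 0) (fun t _ => by simp)
  have hl := eq_mul_exp_of_hasDerivWithinAt (r := 0)
    (fun t ht => (h.left t ht).congr_deriv (by simp)) ht
  have hr := eq_mul_exp_of_hasDerivWithinAt (r := 0)
    (fun t ht => (h.right t ht).congr_deriv (by simp)) ht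
  simp only [zero_smul, NormedSpace.exp_zero, Matrix.one_mulVec, mul_zero, exp_zero, cos_zero,
    sin_zero, zero_mul, mul_one, one_mul, sub_zero, zero_add] at hl hr
  have hsc := sin_sq_add_cos_sq (c.ω * t)
  constructor
  · linear_combination cos (c.ω * t) * hl + sin (c.ω * t) * hr - exp (c.γ / 2 * t) *
      c.totalCurrent (NormedSpace.exp (t • c.A) *ᵥ v) * hsc
  · linear_combination -sin (c.ω * t) * hl + cos (c.ω * t) * hr - exp (c.γ / 2 * t) *
      c.quadrature (NormedSpace.exp (t • c.A) *ᵥ v) * hsc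

open Real in
theorem totalCurrent_sq_add_quadrature_sq_exp_smul_A (hω : 0 < c.omegaSq)
    (v : Fin c.n × Fin 2 → ℝ) {t : ℝ} (ht : 0 ≤ t) :
    exp (c.γ * t) * (c.totalCurrent (NormedSpace.exp (t • c.A) *ᵥ v) ^ 2 +
      c.quadrature (NormedSpace.exp (t • c.A) *ᵥ v) ^ 2) =
        c.totalCurrent v ^ 2 + c.quadrature v ^ 2 := by
  obtain ⟨h1, h2⟩ := totalCurrent_exp_smul_A hω v ht
  have e : exp (c.γ * t) = exp (c.γ / 2 * t) ^ 2 := by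
    rw [sq, ← exp_add]; ring_nf
  rw [e, mul_add, ← mul_pow, ← mul_pow, h1, h2]
  linear_combination (c.totalCurrent v ^ 2 + c.quadrature v ^ 2) * sin_sq_add_cos_sq (c.ω * t)

theorem deviationEnergy_exp_smul_A_le (i : Fin c.n) (v : Fin c.n × Fin 2 → ℝ) {t : ℝ}
    (ht : 0 ≤ t) :
    c.deviationEnergy i (NormedSpace.exp (t • c.A) *ᵥ v) ≤ c.deviationEnergy i v := by
  simpa using (isModulated_exp_smul_A v).deviationEnergy_le i ht

-- The flow of `A` is controlled only forward in time, so the claimed vector is pushed forward by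
-- `exp(tA)` instead. Its circuits all agree, so its deviation energy is zero and remains zero; the
-- image is then determined by its total and quadrature.
open Real in
theorem exp_neg_smul_A_mulVec (hω : 0 < c.omegaSq) {t : ℝ} (ht : 0 ≤ t) :
    NormedSpace.exp (-(t • c.A)) *ᵥ (fun p => if p.2 = 0 then 0 else 1) =
      fun p => exp (c.γ / 2 * t) * (if p.2 = 0 then -(sin (c.ω * t) / c.ω) else
        cos (c.ω * t) + c.γ / (2 * c.ω) * sin (c.ω * t)) := by
  have hω0 := (ω_pos hω).ne'
  have hn := c.n_cast_pos.ne'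
  set g : Fin c.n × Fin 2 → ℝ := fun p => exp (c.γ / 2 * t) *
    (if p.2 = 0 then -(sin (c.ω * t) / c.ω) else
      cos (c.ω * t) + c.γ / (2 * c.ω) * sin (c.ω * t)) with hg
  set w := NormedSpace.exp (t • c.A) *ᵥ g with hw
  have hE := exp_pos (c.γ / 2 * t)
  have hg0 : c.totalCurrent g = -(c.n * exp (c.γ / 2 * t) * sin (c.ω * t) / c.ω) := by
    simp [totalCurrent, hg]; ring
  have hg1 : c.quadrature g = c.n * exp (c.γ / 2 * t) * cos (c.ω * t) / c.ω := by
    simp [quadrature, hg]; field_simp; ring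
  obtain ⟨h0, h1⟩ := totalCurrent_exp_smul_A hω g ht
  rw [← hw, hg0, hg1] at h0 h1
  have hS : ∑ i, w (i, 0) = 0 := by
    have : exp (c.γ / 2 * t) * c.totalCurrent w = 0 := by rw [h0]; ring
    exact (mul_eq_zero.1 this).resolve_left hE.ne'
  have hV : c.quadrature w = c.n / c.ω := by
    refine mul_left_cancel₀ hE.ne' (h1.trans ?_)
    linear_combination (c.n * exp (c.γ / 2 * t) / c.ω) * sin_sq_add_cos_sq (c.ω * t)
  have hT : ∑ i, w (i, 1) = c.n := by
    rw [quadrature, hS] at hV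
    field_simp at hV
    linarith
  have hwone : w = fun p => if p.2 = 0 then 0 else 1 := by
    funext p
    obtain ⟨i, k⟩ := p
    have hd := deviationEnergy_exp_smul_A_le i g ht
    rw [← hw] at hd
    have hd0 : c.deviationEnergy i g = 0 := by
      have h : ∀ k, g (i, k) - (∑ j, g (j, k)) / c.n = 0 := fun k => by
        have e : ∑ j, g (j, k) = c.n * g (i, k) := by
          have : ∑ _j : Fin c.n, g (i, k) = c.n * g (i, k) := by
            rw [Finset.sum_const, Finset.card_univ, Fintype.card_fin, nsmul_eq_mul]
          exact this
        rw [e, mul_div_cancel_left₀ _ hn, sub_self]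
      rw [deviationEnergy, h, h]
      ring
    rw [hd0, deviationEnergy, hS, hT, div_self hn, zero_div, sub_zero] at hd
    have hLC : 0 < 1 / (c.L * c.C) := one_div_pos.2 (mul_pos c.L_pos c.C_pos)
    have hp := mul_nonneg hLC.le (sq_nonneg (w (i, 0)))
    have hq := sq_nonneg (w (i, 1) - 1)
    obtain rfl | rfl : k = 0 ∨ k = 1 := by omega
    · have : 1 / (c.L * c.C) * w (i, 0) ^ 2 = 0 := by linarith
      simpa [hLC.ne', c.L_pos.ne', c.C_pos.ne'] using this
    · have : (w (i, 1) - 1) ^ 2 = 0 := by linarith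
      have := pow_eq_zero_iff (two_ne_zero) |>.1 this
      simp
      linarith
  rw [← hwone, hw, Matrix.mulVec_mulVec]
  have : NormedSpace.exp (-(t • c.A)) * NormedSpace.exp (t • c.A) = 1 := by
    rw [← Matrix.exp_add_of_commute _ _ (Commute.refl (t • c.A)).neg_left, neg_add_cancel,
      NormedSpace.exp_zero]
  rw [this, Matrix.one_mulVec]

/-- The `2 × 2` block that fills the effective matrix. -/
noncomputable def effectiveBlock (c : CoupledRLC) : Matrix (Fin 2) (Fin 2) ℝ :=
  !![-(c.γ / (8 * c.ω ^ 2)), -(1 / (4 * c.ω ^ 2));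
    -(1 - c.γ ^ 2 / (4 * c.ω ^ 2)) / 4, c.γ / (8 * c.ω ^ 2)]

/-- The effective matrix of the coupled circuits. -/
noncomputable def effectiveMatrix (c : CoupledRLC) : Matrix (Fin c.n × Fin 2) (Fin c.n × Fin 2) ℝ :=
  Matrix.of fun p q => c.effectiveBlock p.2 q.2

/-- `P(t)` has rank one, so each conjugated entry factors into a coordinate of a backward trajectory
and the total current of a forward one. -/
theorem conjugated_P_apply (t : ℝ) (X Y : Matrix (Fin c.n × Fin 2) (Fin c.n × Fin 2) ℝ)
    (p q : Fin c.n × Fin 2) :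
    (X * c.P t * Y) p q = -Real.cos (2 * c.ω * t) *
      (X *ᵥ (fun p => if p.2 = 0 then 0 else 1)) p *
      c.totalCurrent (Y *ᵥ Pi.single q 1) := by
  have hP : c.P t = Matrix.vecMulVec (fun p => if p.2 = 0 then 0 else 1)
      (fun q => if q.2 = 0 then -Real.cos (2 * c.ω * t) else 0) := by
    ext ⟨i, k⟩ ⟨j, l⟩
    fin_cases k <;> fin_cases l <;> simp [P, forcingBlock, Matrix.vecMulVec_apply]
  rw [hP, Matrix.mul_vecMulVec, Matrix.vecMulVec_mul, Matrix.vecMulVec_apply, totalCurrent]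
  simp only [Matrix.mulVec_single_one, Matrix.vecMul, dotProduct, Fintype.sum_prod_type,
    Fin.sum_univ_two, Matrix.col_apply]
  simp [← Finset.mul_sum]
  ring

open Real in
theorem isEffectiveMatrix_effectiveMatrix (hω : 0 < c.omegaSq) :
    c.IsEffectiveMatrix c.effectiveMatrix := by
  have hω0 := ω_pos hω
  -- The growth of `exp(-At)` cancels the decay of the total current, so every entry is `cos 2ωt`
  -- times a quadratic form in `cos ωt`, `sin ωt`, with average `(a - b)/4`.
  have key : ∀ p q : Fin c.n × Fin 2, ∀ a b d : ℝ,
      (∀ t, 0 ≤ t → -((if p.2 = 0 then -(sin (c.ω * t) / c.ω) else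
        cos (c.ω * t) + c.γ / (2 * c.ω) * sin (c.ω * t)) *
        (c.totalCurrent (Pi.single q 1) * cos (c.ω * t) +
          c.quadrature (Pi.single q 1) * sin (c.ω * t))) =
        a * cos (c.ω * t) ^ 2 + b * sin (c.ω * t) ^ 2 + 2 * d * (sin (c.ω * t) * cos (c.ω * t))) →
      (a - b) / 4 = c.effectiveMatrix p q →
      Filter.Tendsto (fun T : ℝ => 1 / T * ∫ τ in (0 : ℝ)..T,
        (NormedSpace.exp (-(τ • c.A)) * c.P τ * NormedSpace.exp (τ • c.A)) p q)
        Filter.atTop (nhds (c.effectiveMatrix p q)) := fun p q a b d h hab => by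
    rw [← hab]
    refine (tendsto_average_cos_two_mul hω0 a b d).congr' ?_
    filter_upwards [Filter.eventually_gt_atTop 0] with T hT
    congr 1
    refine intervalIntegral.integral_congr fun t ht => ?_
    rw [Set.uIcc_of_le hT.le] at ht
    have h1 := (totalCurrent_exp_smul_A hω (Pi.single q 1) ht.1).1
    refine Eq.trans ?_ (conjugated_P_apply t _ _ p q).symm
    rw [exp_neg_smul_A_mulVec hω ht.1, ← h t ht.1, ← h1]
    ring
  rintro ⟨i, k⟩ ⟨j, l⟩
  have hs : ∀ l' : Fin 2, ∑ i, (Pi.single (j, l) 1 : Fin c.n × Fin 2 → ℝ) (i, l') =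
      if l' = l then 1 else 0 := fun l' => by
    simp [Pi.single_apply, Prod.ext_iff, ite_and]
  have hS : c.totalCurrent (Pi.single (j, l) 1) = if l = 0 then 1 else 0 := by
    rw [totalCurrent, hs]; simp [eq_comm]
  have hV : c.quadrature (Pi.single (j, l) 1) = if l = 0 then c.γ / (2 * c.ω) else 1 / c.ω := by
    rw [quadrature, hs, hs]
    obtain rfl | rfl : l = 0 ∨ l = 1 := by omega
    · simp; field_simp
    · simp
  obtain rfl | rfl : k = 0 ∨ k = 1 := (by omega) <;>
    obtain rfl | rfl : l = 0 ∨ l = 1 := by omega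
  · refine key _ _ 0 (c.γ / (2 * c.ω ^ 2)) (1 / (2 * c.ω)) (fun t _ => ?_) ?_
    · rw [hS, hV]; simp; field_simp; ring
    · simp [effectiveMatrix, effectiveBlock]; field_simp; ring
  · refine key _ _ 0 (1 / c.ω ^ 2) 0 (fun t _ => ?_) ?_
    · rw [hS, hV]; simp; field_simp
    · simp [effectiveMatrix, effectiveBlock]; field_simp
  · refine key _ _ (-1) (-(c.γ / (2 * c.ω)) ^ 2) (-(c.γ / (2 * c.ω))) (fun t _ => ?_) ?_
    · rw [hS, hV]; simp; field_simp; ring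
    · simp [effectiveMatrix, effectiveBlock]; field_simp; ring
  · refine key _ _ 0 (-(c.γ / (2 * c.ω ^ 2))) (-(1 / (2 * c.ω))) (fun t _ => ?_) ?_
    · rw [hS, hV]; simp; field_simp; ring
    · simp [effectiveMatrix, effectiveBlock]; field_simp; ring

/-! ### Homogenized trajectories. -/

theorem effectiveMatrix_mulVec (y : Fin c.n × Fin 2 → ℝ) (i : Fin c.n) (k : Fin 2) :
    (c.effectiveMatrix *ᵥ y) (i, k) = c.effectiveBlock k 0 * ∑ j, y (j, 0) +
      c.effectiveBlock k 1 * ∑ j, y (j, 1) := by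
  simp only [Matrix.mulVec, dotProduct, Fintype.sum_prod_type, Fin.sum_univ_two, effectiveMatrix,
    Matrix.of_apply, Finset.sum_add_distrib, Finset.mul_sum]

theorem hasDerivWithinAt_exp_effectiveMatrix (v : Fin c.n × Fin 2 → ℝ) (i : Fin c.n) (k : Fin 2)
    (t : ℝ) :
    HasDerivWithinAt (fun s => (NormedSpace.exp ((c.ε * s) • c.effectiveMatrix) *ᵥ v) (i, k))
      (c.ε * (c.effectiveBlock k 0 *
        ∑ j, (NormedSpace.exp ((c.ε * t) • c.effectiveMatrix) *ᵥ v) (j, 0) +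
      c.effectiveBlock k 1 *
        ∑ j, (NormedSpace.exp ((c.ε * t) • c.effectiveMatrix) *ᵥ v) (j, 1))) (Set.Ici 0) t := by
  have h := (hasDerivAt_exp_smul_mulVec (c.ε • c.effectiveMatrix) v (i, k) t).hasDerivWithinAt
    (s := Set.Ici 0)
  simp only [smul_smul, mul_comm _ c.ε, Matrix.smul_mulVec, Pi.smul_apply, effectiveMatrix_mulVec,
    smul_eq_mul] at h
  exact h

theorem hasDerivWithinAt_sum_exp_effectiveMatrix (v : Fin c.n × Fin 2 → ℝ) (k : Fin 2) (t : ℝ) :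
    HasDerivWithinAt (fun s => ∑ i, (NormedSpace.exp ((c.ε * s) • c.effectiveMatrix) *ᵥ v) (i, k))
      (c.n * (c.ε * (c.effectiveBlock k 0 *
        ∑ j, (NormedSpace.exp ((c.ε * t) • c.effectiveMatrix) *ᵥ v) (j, 0) +
      c.effectiveBlock k 1 *
        ∑ j, (NormedSpace.exp ((c.ε * t) • c.effectiveMatrix) *ᵥ v) (j, 1)))) (Set.Ici 0) t := by
  refine (HasDerivWithinAt.fun_sum fun i _ =>
    hasDerivWithinAt_exp_effectiveMatrix v i k t).congr_deriv ?_
  simp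

/-- The range of `B` consists of states that agree in all circuits, so its flow leaves every
deviation from the mean constant. -/
theorem deviationEnergy_exp_effectiveMatrix (i : Fin c.n) (v : Fin c.n × Fin 2 → ℝ) {t : ℝ}
    (ht : 0 ≤ t) :
    c.deviationEnergy i (NormedSpace.exp ((c.ε * t) • c.effectiveMatrix) *ᵥ v) =
      c.deviationEnergy i v := by
  have hn := c.n_cast_pos.ne'
  have h : ∀ k, (NormedSpace.exp ((c.ε * t) • c.effectiveMatrix) *ᵥ v) (i, k) -
      (∑ j, (NormedSpace.exp ((c.ε * t) • c.effectiveMatrix) *ᵥ v) (j, k)) / c.n =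
      v (i, k) - (∑ j, v (j, k)) / c.n := fun k => by
    have := eq_mul_exp_of_hasDerivWithinAt (r := 0) (fun t _ =>
      ((hasDerivWithinAt_exp_effectiveMatrix v i k t).sub
        ((hasDerivWithinAt_sum_exp_effectiveMatrix v k t).div_const c.n)).congr_deriv
          (by rw [mul_div_cancel_left₀ _ hn]; ring)) ht
    simpa using this
  rw [deviationEnergy, deviationEnergy, h, h]

-- `S - V` and `S + V` are left eigenvectors of `εB`, with eigenvalues `μ/4` and `-μ/4`.
open Real in
theorem totalCurrent_exp_effectiveMatrix (hω : 0 < c.omegaSq) (v : Fin c.n × Fin 2 → ℝ) {t : ℝ}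
    (ht : 0 ≤ t) :
    c.totalCurrent (NormedSpace.exp ((c.ε * t) • c.effectiveMatrix) *ᵥ v) -
        c.quadrature (NormedSpace.exp ((c.ε * t) • c.effectiveMatrix) *ᵥ v) =
        (c.totalCurrent v - c.quadrature v) * exp (c.ε * (c.n / c.ω) / 4 * t) ∧
      c.totalCurrent (NormedSpace.exp ((c.ε * t) • c.effectiveMatrix) *ᵥ v) +
        c.quadrature (NormedSpace.exp ((c.ε * t) • c.effectiveMatrix) *ᵥ v) =
        (c.totalCurrent v + c.quadrature v) * exp (-(c.ε * (c.n / c.ω) / 4) * t) := by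
  have hω0 := (ω_pos hω).ne'
  have d0 := hasDerivWithinAt_sum_exp_effectiveMatrix v 0
  have dV : ∀ t, HasDerivWithinAt
      (fun s => c.quadrature (NormedSpace.exp ((c.ε * s) • c.effectiveMatrix) *ᵥ v)) _ _ t :=
    fun t => ((hasDerivWithinAt_sum_exp_effectiveMatrix v 1 t).add
      ((d0 t).const_mul (c.γ / 2))).div_const c.ω
  constructor
  · have := eq_mul_exp_of_hasDerivWithinAt (r := c.ε * (c.n / c.ω) / 4) (fun t _ =>
      ((d0 t).sub (dV t)).congr_deriv (by
        simp only [Pi.sub_apply, quadrature, effectiveBlock]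
        simp
        field_simp
        ring)) ht
    simpa [totalCurrent] using this
  · have := eq_mul_exp_of_hasDerivWithinAt (r := -(c.ε * (c.n / c.ω) / 4)) (fun t _ =>
      ((d0 t).add (dV t)).congr_deriv (by
        simp only [Pi.add_apply, quadrature, effectiveBlock]
        simp
        field_simp
        ring)) ht
    simpa [totalCurrent] using this

/-- The linear map that sends an initial state to its homogenized trajectory. -/
noncomputable def homogenizedMap (c : CoupledRLC) : c.State →ₗ[ℝ] ℝ → c.State where
  toFun x₀ := c.homogenized c.effectiveMatrix x₀
  map_add' x y := by
    funext t
    simp [homogenized, Matrix.mulVec_add]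
  map_smul' r x := by
    funext t
    simp [homogenized, Matrix.mulVec_smul]

open Real in
theorem exists_hyperplane_homogenized (hω : 0 < c.omegaSq) :
    ∃ E : Submodule ℝ c.State, Module.finrank ℝ E = 2 * c.n - 1 ∧
      ∀ x₀ : c.State, x₀ ∉ E → (c.IsUnbounded (c.homogenized c.effectiveMatrix x₀) ↔
        c.ε * (c.n / c.ω) > 2 * c.γ) := by
  have hω0 := ω_pos hω
  have hn := c.n_cast_pos
  have hμ : 0 < c.ε * (c.n / c.ω) := mul_pos c.ε_pos (div_pos hn hω0)
  have hzero : ∀ x₀ : c.State, c.homogenized c.effectiveMatrix x₀ 0 = x₀ := fun x₀ => by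
    simp [homogenized]
  -- Since `S² + V² = ((S - V)² + (S + V)²)/2`, the damped rotation `exp(At)` and the hyperbolic
  -- flow of `B` combine into an exact formula.
  have hsize : ∀ (x₀ : c.State) (t : ℝ), 0 ≤ t →
      exp (c.γ * t) * (c.totalCurrent (c.homogenized c.effectiveMatrix x₀ t).ofLp ^ 2 +
        c.quadrature (c.homogenized c.effectiveMatrix x₀ t).ofLp ^ 2) =
      (c.totalCurrent x₀.ofLp - c.quadrature x₀.ofLp) ^ 2 / 2 *
          exp (c.ε * (c.n / c.ω) / 2 * t) +
        (c.totalCurrent x₀.ofLp + c.quadrature x₀.ofLp) ^ 2 / 2 *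
          exp (-(c.ε * (c.n / c.ω) / 4) * t) ^ 2 := fun x₀ t ht => by
    have h := totalCurrent_sq_add_quadrature_sq_exp_smul_A hω
      (NormedSpace.exp ((c.ε * t) • c.effectiveMatrix) *ᵥ x₀.ofLp) ht
    obtain ⟨h1, h2⟩ := totalCurrent_exp_effectiveMatrix hω x₀.ofLp ht
    have e : exp (c.ε * (c.n / c.ω) / 2 * t) = exp (c.ε * (c.n / c.ω) / 4 * t) ^ 2 := by
      rw [sq, ← exp_add]; ring_nf
    rw [Matrix.mulVec_mulVec] at h
    rw [homogenized, h, e]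
    linear_combination (exp := 1) ((c.totalCurrent (NormedSpace.exp ((c.ε * t) •
      c.effectiveMatrix) *ᵥ x₀.ofLp) - c.quadrature (NormedSpace.exp ((c.ε * t) •
      c.effectiveMatrix) *ᵥ x₀.ofLp) + (c.totalCurrent x₀.ofLp - c.quadrature x₀.ofLp) *
      exp (c.ε * (c.n / c.ω) / 4 * t)) / 2) * h1 + ((c.totalCurrent (NormedSpace.exp ((c.ε * t) •
      c.effectiveMatrix) *ᵥ x₀.ofLp) + c.quadrature (NormedSpace.exp ((c.ε * t) •
      c.effectiveMatrix) *ᵥ x₀.ofLp) + (c.totalCurrent x₀.ofLp + c.quadrature x₀.ofLp) *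
      exp (-(c.ε * (c.n / c.ω) / 4) * t)) / 2) * h2
  suffices h : ∃ E : Submodule ℝ c.State, Module.finrank ℝ E = 2 * c.n - 1 ∧
      ∀ x ∈ LinearMap.range c.homogenizedMap, x 0 ∉ E →
        (c.IsUnbounded x ↔ c.ε * (c.n / c.ω) > 2 * c.γ) by
    obtain ⟨E, hE, h⟩ := h
    refine ⟨E, hE, fun x₀ hx₀ => h _ ⟨x₀, rfl⟩ ?_⟩
    rwa [hzero]
  refine c.exists_hyperplane _ (fun hp => ?_) (fun hnp => ?_)
  · refine ⟨WithLp.toLp 2 fun p => if p.2 = 0 then 1 / c.n else (-c.ω - c.γ / 2) / c.n, ?_⟩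
    rintro _ ⟨x₀, rfl⟩ hxv ⟨M, hM⟩
    change c.homogenized c.effectiveMatrix x₀ 0 = _ at hxv
    rw [hzero] at hxv
    obtain ⟨K, hK⟩ := c.exists_totalCurrent_sq_add_quadrature_sq_le M
    have h0 : c.totalCurrent x₀.ofLp = 1 := by
      rw [hxv, totalCurrent]; simp [hn.ne']
    have h1 : c.quadrature x₀.ofLp = -1 := by
      rw [hxv, quadrature]; simp; field_simp; ring
    refine not_forall_mul_exp_le (r := c.ε * (c.n / c.ω) / 2 - c.γ) (k := 2) (M := K)
      (by linarith) two_pos fun t ht => ?_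
    have h := hsize x₀ t ht
    rw [h0, h1] at h
    have hle := mul_le_mul_of_nonneg_left (hK _ (hM t ht)) (exp_pos (c.γ * t)).le
    change exp (c.γ * t) * (c.totalCurrent (c.homogenized c.effectiveMatrix x₀ t).ofLp ^ 2 +
        c.quadrature (c.homogenized c.effectiveMatrix x₀ t).ofLp ^ 2) ≤ _ at hle
    rw [h] at hle
    rw [sub_mul, exp_sub, ← mul_div_assoc, div_le_iff₀ (exp_pos _), mul_comm K]
    norm_num at hle
    exact hle
  · rintro _ ⟨x₀, rfl⟩
    have hγ := c.γ_nonneg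
    obtain ⟨M, hM⟩ := exists_norm_le hω
      ((c.totalCurrent x₀.ofLp - c.quadrature x₀.ofLp) ^ 2 / 2 +
        (c.totalCurrent x₀.ofLp + c.quadrature x₀.ofLp) ^ 2 / 2)
      (fun i => c.deviationEnergy i x₀.ofLp)
    refine not_not.2 ⟨M, fun t ht => hM _ ?_ fun i => ?_⟩
    · refine le_of_mul_le_mul_left ((hsize x₀ t ht).trans_le ?_) (exp_pos (c.γ * t))
      rw [mul_add, mul_comm (exp _), mul_comm (exp _)]
      gcongr
      · linarith
      · refine (pow_le_one₀ (exp_pos _).le (exp_le_one_iff.2 ?_)).trans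
          (one_le_exp (mul_nonneg hγ ht))
        have := mul_nonneg hμ.le ht
        linarith
    · have h := deviationEnergy_exp_smul_A_le i
        (NormedSpace.exp ((c.ε * t) • c.effectiveMatrix) *ᵥ x₀.ofLp) ht
      rw [deviationEnergy_exp_effectiveMatrix i _ ht, Matrix.mulVec_mulVec] at h
      exact h

end CoupledRLC

theorem corollary19 :
    -- the leading-order (homogenized) solution: exact criterion for all parameter values
    (∀ c : CoupledRLC, 0 < c.omegaSq →
      ∃ B : Matrix (Fin c.n × Fin 2) (Fin c.n × Fin 2) ℝ, c.IsEffectiveMatrix B ∧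
        ∃ E : Submodule ℝ c.State, Module.finrank ℝ E = 2 * c.n - 1 ∧
          ∀ x₀ : c.State, x₀ ∉ E →
            (c.IsUnbounded (c.homogenized B x₀) ↔ c.ε * (c.n / c.ω) > 2 * c.γ)) ∧
    -- the solutions themselves: small fluctuations, at a fixed relative distance of the threshold
    (∀ θ : ℝ, 0 < θ → ∃ δ : ℝ, 0 < δ ∧
      ∀ c : CoupledRLC, 0 < c.omegaSq → c.ε * c.n ≤ δ * c.ω ^ 2 →
        θ * (2 * c.γ) ≤ |c.ε * (c.n / c.ω) - 2 * c.γ| →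
          (∃ E : Submodule ℝ c.State, Module.finrank ℝ E = 2 * c.n - 1 ∧
            ∀ x : ℝ → c.State, c.IsFirstOrderSolution x → x 0 ∉ E →
              (c.IsUnbounded x ↔ c.ε * (c.n / c.ω) > 2 * c.γ)) ∧
          (c.η ≤ δ →
            ∃ E : Submodule ℝ c.State, Module.finrank ℝ E = 2 * c.n - 1 ∧
              ∀ x : ℝ → c.State, c.IsCircuitSolution x → x 0 ∉ E →
                (c.IsUnbounded x ↔ c.ε * (c.n / c.ω) > 2 * c.γ))) := by
  refine ⟨fun c hω => ⟨_, CoupledRLC.isEffectiveMatrix_effectiveMatrix hω,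
    -- Capping `θ` at `1/2` only weakens the gap hypothesis; dividing by `100` makes the rate errors
    -- `19δ` and `13δ` small against `θ`.
    CoupledRLC.exists_hyperplane_homogenized hω⟩, fun θ hθ => ⟨min θ (1 / 2) / 100, by positivity,
    fun c hω hsmall hgap => ?_⟩⟩
  have hθ' : 0 < min θ (1 / 2) := by positivity
  have hgap' : min θ (1 / 2) * (2 * c.γ) ≤ |c.ε * (c.n / c.ω) - 2 * c.γ| :=
    (mul_le_mul_of_nonneg_right (min_le_left _ _) (mul_nonneg two_pos.le c.γ_nonneg)).trans hgap
  constructor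
  · obtain ⟨E, hE, h⟩ := CoupledRLC.exists_hyperplane_modulatedSolutions hω hθ' (min_le_right _ _)
      (m := fun t => Real.cos (2 * (c.ω * t))) (fun _ _ => rfl) (fun t _ => by
        rw [sub_self, abs_zero]; positivity) hsmall hgap'
    exact ⟨E, hE, fun x hx => h x hx.mem_modulatedSolutions⟩
  · intro hη
    have hη' : c.η ≤ 1 / 2 := by
      have := min_le_right θ (1 / 2)
      linarith
    choose m hm hm' using c.sharedCapacitance_modulation hη'
    obtain ⟨E, hE, h⟩ := CoupledRLC.exists_hyperplane_modulatedSolutions hω hθ' (min_le_right _ _)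
      (fun t _ => hm t) (fun t _ => (hm' t).trans (by linarith)) hsmall hgap'
    exact ⟨E, hE, fun x hx => h x hx.mem_modulatedSolutions⟩
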